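/- Let $\mathcal G=(\mathcal V,\mathcal E,\{\varphi_e\}_{e\in\mathcal E})$ be a graph with Euclidean edges: $(\mathcal V,\mathcal E)$ is a finite simple connected graph, every edge $e$ is also an abstract set of points (these sets and $\mathcal V$ are mutually disjoint), and $\varphi_e$ is a bijection from $e$ together with the two endpoints $\underline u_e,\overline u_e\in\mathcal V$ of $e$ onto a compact interval $[\underline e,\overline e]\subset\mathbb R$, $\underline e<\overline e$, that maps $e$ onto $(\underline e,\overline e)$, $\underline u_e$ to $\underline e$ and $\overline u_e$ to $\overline e$. Its points are $u\in\mathcal V\cup\bigcup_{e}e$. Put $c(u,v)=1/(\overline e-\underline e)$ if the vertices $u,v$ are joined by the edge $e$, and $c(u,v)=0$ otherwise; fix a vertex $u_0$, and let $L$ be the matrix with $L(u,u)=\sum_w c(u,w)+\mathbf 1_{u=u_0}$ and $L(u,v)=-c(u,v)$ for $u\ne v$. Let $Z_\mu$ be a centred Gaussian vector indexed by $\mathcal V$ with covariance matrix $L^{-1}$, and let $B_e$ ($e\in\mathcal E$) be standard Brownian bridges on $[\underline e,\overline e]$ (centred Gaussian, continuous, with covariance $(s-\underline e)(\overline e-t)/(\overline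 e-\underline e)$ for $s\le t$), all mutually independent and independent of $Z_\mu$. Define $Z_{\mathcal G}(u)=Z_\mu(u)$ for $u\in\mathcal V$, and $Z_{\mathcal G}(u)=(1-d(u))Z_\mu(\underline u_e)+d(u)Z_\mu(\overline u_e)+B_e(\varphi_e(u))$ for $u\in e$, where $d(u)=(\varphi_e(u)-\underline e)/(\overline e-\underline e)$. The resistance metric is $d_R(u,v)=\operatorname{var}(Z_{\mathcal G}(u)-Z_{\mathcal G}(v))$. Let $F$ be a probability measure on $\mathbb R$ with $F(\{0\})=0$, let $V\sim\mathrm{Unif}(0,1)$, $\Lambda\sim\mathrm{Unif}(0,2\pi)$, $W\sim F$, let $Z_{\mathcal G}(\cdot)$, $V$, $\Lambda$, $W$ be independent, and set $$Y(u)=\sqrt{-2\ln V}\,\cos\bigl(Z_{\mathcal G}(u)W+\Lambda\bigr),\qquad u\in\mathcal G .$$ For points $u,v$ let $\rho(u,v)=\cos\bigl(WZ\sqrt{d_R(u,v)}\bigr)$, where $Z$ is a standard Gaussian random variable independent of $W$. Then: 1. For every $u\in\mathcal G$, $Y(u)$ is standard Gaussian. 2. The law of $(Y(u),Y(v))$ depends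 on $u,v\in\mathcal G$ only through $d_R(u,v)$. 3. For all $u,v\in\mathcal G$, the law of $(Y(u),Y(v))$ is the mixture of the centred bivariate Gaussian laws with unit variances and correlation $r$, where $r$ is distributed as $\rho(u,v)$. 4. For all $u,v\in\mathcal G$ with $u\neq v$, $(Y(u),Y(v))$ has a probability density $g_{u,v}:\mathbb R^2\to[0,\infty]$, with $g_{u,v}(y,y')<\infty$ whenever $|y|\neq|y'|$, such that $$g_{u,v}(y,y')=g(y)\,g(y')\sum_{\nu=0}^\infty \mathbb E\bigl[\rho(u,v)^\nu\bigr]\,H_\nu(y)\,H_\nu(y'),\qquad y,y'\in\mathbb R ,$$ where $g$ is the standard Gaussian density and $H_\nu$ is the Hermite polynomial of degree $\nu$, normalized so that $\int H_\nu^2\,g=1$. The series is understood as the limit of its partial sums, in $(-\infty,+\infty]$. -/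

import Mathlib

open MeasureTheory ProbabilityTheory Filter Topology
open scoped ENNReal

noncomputable section

/-- A graph with Euclidean edges on the vertex set `Vert`: a simple connected graph, an abstract
set `Pt e` of points for every edge `e`, and for every edge a bijection `φ_e` of
`Pt e ∪ {endpoints of e}` onto a compact interval `[lower e, upper e]`, that maps `Pt e` onto the
open interval (`chart e`), the endpoint `src e` to `lower e` and the endpoint `tgt e`
to `upper e`. -/
structure EuclideanEdgeGraph (Vert : Type*) where
  graph : SimpleGraph Vert
  connected : graph.Connected
  lower : graph.edgeSet → ℝ
  upper : graph.edgeSet → ℝ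
  lower_lt_upper : ∀ e, lower e < upper e
  src : graph.edgeSet → Vert
  tgt : graph.edgeSet → Vert
  endpoints : ∀ e, s(src e, tgt e) = (e : Sym2 Vert)
  Pt : graph.edgeSet → Type*
  chart : ∀ e, Pt e ≃ Set.Ioo (lower e) (upper e)

namespace EuclideanEdgeGraph

variable {Vert : Type*} (G : EuclideanEdgeGraph Vert)

/-- The points of the graph: the disjoint union of the vertices and of all the edge sets. -/
abbrev Point := Vert ⊕ (Σ e : G.graph.edgeSet, G.Pt e)

/-- The length of an edge. -/
def length (e : G.graph.edgeSet) : ℝ := G.upper e - G.lower e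

open Classical in
/-- The conductance `c(u,v)`: inverse edge length for neighbours, `0` otherwise. -/
def conductance (u v : Vert) : ℝ :=
  if h : G.graph.Adj u v then 1 / G.length ⟨s(u, v), h⟩ else 0

/-- The modified Laplacian matrix `L`, with the extra term `1` at the diagonal entry of `u₀`. -/
def modLaplacian [Fintype Vert] [DecidableEq Vert] (u₀ : Vert) : Matrix Vert Vert ℝ :=
  Matrix.of fun u v =>
    if u = v then (if u = u₀ then 1 + ∑ w, G.conductance u w else ∑ w, G.conductance u w)
    else - G.conductance u v

/-- The closed interval on which the Brownian bridge of the edge `e` lives. -/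
abbrev Interval (e : G.graph.edgeSet) := Set.Icc (G.lower e) (G.upper e)

/-- The relative position `d(u) ∈ (0,1)` of a point inside an edge. -/
def relPos (e : G.graph.edgeSet) (x : G.Pt e) : ℝ :=
  ((G.chart e x : ℝ) - G.lower e) / G.length e

variable {Ω : Type*}

/-- The vertex field, extended to the edges by linear interpolation. -/
def interpolated (Zvert : Vert → Ω → ℝ) : G.Point → Ω → ℝ
  | Sum.inl v, ω => Zvert v ω
  | Sum.inr ⟨e, x⟩, ω =>
      (1 - G.relPos e x) * Zvert (G.src e) ω + G.relPos e x * Zvert (G.tgt e) ω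

/-- The sum over all edges of the fields `Z_e`, where `Z_e = B_e ∘ φ_e` on the edge set `e` and
`Z_e = 0` elsewhere: at most one term of the sum is not zero. -/
def bridgeSum (B : ∀ e : G.graph.edgeSet, G.Interval e → Ω → ℝ) : G.Point → Ω → ℝ
  | Sum.inl _, _ => 0
  | Sum.inr ⟨e, x⟩, ω => B e ⟨G.chart e x, Set.Ioo_subset_Icc_self (G.chart e x).2⟩ ω

/-- The auxiliary field `Z_G`. -/
def auxField (Zvert : Vert → Ω → ℝ) (B : ∀ e : G.graph.edgeSet, G.Interval e → Ω → ℝ)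
    (u : G.Point) (ω : Ω) : ℝ :=
  G.interpolated Zvert u ω + G.bridgeSum B u ω

end EuclideanEdgeGraph

/-- A standard Brownian bridge on `[a, b]`: a centred Gaussian process with the covariance
`(s - a) (b - t) / (b - a)` for `s ≤ t` and with almost surely continuous paths. -/
structure IsBrownianBridge {Ω : Type*} [MeasurableSpace Ω] {a b : ℝ}
    (B : Set.Icc a b → Ω → ℝ) (P : Measure Ω) : Prop where
  measurable : ∀ t, Measurable (B t)
  isGaussianProcess : IsGaussianProcess B P
  mean_zero : ∀ t, ∫ ω, B t ω ∂P = 0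
  covariance_eq : ∀ s t : Set.Icc a b,
    cov[B s, B t; P] = (min (s : ℝ) t - a) * (b - max (s : ℝ) t) / (b - a)
  continuous_paths : ∀ᵐ ω ∂P, Continuous fun t => B t ω

/-- The ingredients of the auxiliary field: a Gaussian vector with covariance matrix `L⁻¹` on the
vertices, and standard Brownian bridges on the edges, all of them independent. -/
structure IsAuxiliaryInput {Vert : Type*} [Fintype Vert] [DecidableEq Vert]
    (G : EuclideanEdgeGraph Vert) (u₀ : Vert) {Ω : Type*} [MeasurableSpace Ω] (P : Measure Ω)
    (Zvert : Vert → Ω → ℝ) (B : ∀ e : G.graph.edgeSet, G.Interval e → Ω → ℝ) : Prop where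
  measurable_vert : ∀ v, Measurable (Zvert v)
  law_vert : HasLaw (fun ω => WithLp.toLp 2 (fun v => Zvert v ω))
    (multivariateGaussian 0 (G.modLaplacian u₀)⁻¹) P
  bridge : ∀ e, IsBrownianBridge (B e) P
  indep_bridges : iIndepFun (fun (e : G.graph.edgeSet) ω (t : G.Interval e) => B e t ω) P
  indep_vert_bridges : IndepFun (fun ω v => Zvert v ω)
    (fun ω (e : G.graph.edgeSet) (t : G.Interval e) => B e t ω) P

/-- The resistance metric `d_R(u,v) = var(Z_G(u) - Z_G(v))`, for `Z = Z_G`. -/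
def resistance {T Ω : Type*} [MeasurableSpace Ω] (P : Measure Ω) (Z : T → Ω → ℝ) (u v : T) : ℝ :=
  Var[fun ω => Z u ω - Z v ω; P]

/-- The field `Y(u) = √(-2 ln V) cos(Z(u) W + Λ)`. -/
def spectralField {T Ω : Type*} (Z : T → Ω → ℝ) (V Λ W : Ω → ℝ) (u : T) (ω : Ω) : ℝ :=
  Real.sqrt (-2 * Real.log (V ω)) * Real.cos (Z u ω * W ω + Λ ω)

/-- The law of `ρ = cos(W Z √d)`, where `W ∼ F` and `Z` is standard Gaussian independent
of `W`. -/
def corrLaw (F : Measure ℝ) (d : ℝ) : Measure ℝ :=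
  (F.prod (gaussianReal 0 1)).map fun p => Real.cos (p.1 * p.2 * Real.sqrt d)

/-- The bivariate Gaussian law with standard marginals and correlation `r` (for `|r| ≤ 1`). -/
def bivariateGaussian (r : ℝ) : Measure (ℝ × ℝ) :=
  (multivariateGaussian (0 : EuclideanSpace ℝ (Fin 2)) !![1, r; r, 1]).map fun x => (x 0, x 1)

/-- The Hermite polynomial of degree `n`, normalized with respect to the standard Gaussian law. -/
def hermiteNormalized (n : ℕ) (y : ℝ) : ℝ :=
  Polynomial.aeval y (Polynomial.hermite n) / Real.sqrt (n.factorial : ℝ)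

end

/-! ### Hermite polynomials: recurrences, size, and partial sums of products. -/

section Hermite

open Polynomial

/-! Fix the field and `W`. By Box–Muller, `√(-2 ln V) (cos Λ, sin Λ)` is a pair of independent
standard Gaussians, and the two values of `Y` are its products with unit vectors at phases `Z(u)W`
and `Z(v)W`. So they are standard bivariate Gaussian with correlation `cos ((Z(u) - Z(v)) W)`. The
increment `Z(u) - Z(v)` is centred Gaussian with variance `d_R(u,v)`, so averaging gives the
mixture; the marginals and the dependence on `d_R` alone follow. This is `lintegral_boxMuller_pair`
and `map_spectral_pair_eq_bind`.

For `u ≠ v` the resistance is positive, by positive definiteness of the Laplacian or by the bridge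
variances. As `F` has no atom at `0`, almost surely `|ρ| < 1`. Each component then has Mehler's
kernel as density, and Mehler's formula expands it.

The delicate point is to average Mehler's series over `ρ`, which may come arbitrarily close to `±1`.
For `r ≥ 0` and `y ≠ y'`, the Christoffel–Darboux formula and the decay `H_n(y) = O(n^(-1/4))` bound
the partial sums at `r = 1`; Abel summation extends the bound to all `r` in `[0, 1]`, and dominated
convergence applies. For `y = y'` all terms are nonnegative and Tonelli applies, possibly with value
`+∞`. Negative `r` reduces to positive `r` by replacing `y` with `-y`. -/

theorem derivative_hermite_succ (n : ℕ) :
    derivative (hermite (n + 1)) = ((n : ℤ[X]) + 1) * hermite n := by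
  induction n with
  | zero => simp [hermite_succ]
  | succ n ih =>
    rw [hermite_succ (n + 1), derivative_sub, derivative_mul, derivative_X, one_mul, ih,
      derivative_mul, hermite_succ n]
    simp
    ring

theorem hermite_add_two (n : ℕ) :
    hermite (n + 2) = X * hermite (n + 1) - ((n : ℤ[X]) + 1) * hermite n := by
  rw [hermite_succ (n + 1), derivative_hermite_succ]

/-- Hermite's differential equation, from which the monotonicity of `hermiteEnergy` comes. -/
theorem derivative_derivative_hermite (n : ℕ) :
    derivative (derivative (hermite n)) = X * derivative (hermite n) - (n : ℤ[X]) * hermite n := by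
  have h := derivative_hermite_succ n
  rw [hermite_succ, derivative_sub, derivative_mul, derivative_X, one_mul] at h
  linear_combination -h

theorem hasDerivAt_aeval_int (p : ℤ[X]) (x : ℝ) :
    HasDerivAt (fun y : ℝ => aeval y p) (aeval x (derivative p)) x := by
  have h := (p.map (Int.castRingHom ℝ)).hasDerivAt x
  simpa [derivative_map, aeval_def, eval_map] using h

theorem hermiteNormalized_mul_sqrt_factorial (n : ℕ) (y : ℝ) :
    hermiteNormalized n y * Real.sqrt (n.factorial : ℝ) = aeval y (hermite n) := by
  rw [hermiteNormalized, div_mul_cancel₀]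
  exact Real.sqrt_ne_zero'.2 (by positivity)

theorem hermiteNormalized_zero (y : ℝ) : hermiteNormalized 0 y = 1 := by
  simp [hermiteNormalized]

theorem hermiteNormalized_one (y : ℝ) : hermiteNormalized 1 y = y := by
  simp [hermiteNormalized]

theorem sqrt_factorial_succ (n : ℕ) :
    Real.sqrt ((n + 1).factorial : ℝ) = Real.sqrt (n + 1) * Real.sqrt (n.factorial : ℝ) := by
  rw [← Real.sqrt_mul (by positivity), Nat.factorial_succ]
  push_cast
  rfl

theorem sqrt_mul_hermiteNormalized_add_two (n : ℕ) (y : ℝ) :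
    Real.sqrt (n + 2) * hermiteNormalized (n + 2) y =
      y * hermiteNormalized (n + 1) y - Real.sqrt (n + 1) * hermiteNormalized n y := by
  have h0 : Real.sqrt (n.factorial : ℝ) ≠ 0 := Real.sqrt_ne_zero'.2 (by positivity)
  have h1 : Real.sqrt ((n : ℝ) + 1) ≠ 0 := Real.sqrt_ne_zero'.2 (by positivity)
  have h2 : Real.sqrt ((n : ℝ) + 2) ≠ 0 := Real.sqrt_ne_zero'.2 (by positivity)
  have e2 : Real.sqrt ((n + 2).factorial : ℝ) = Real.sqrt (n + 2) * Real.sqrt (n + 1) *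
      Real.sqrt (n.factorial : ℝ) := by
    rw [sqrt_factorial_succ, sqrt_factorial_succ]
    push_cast
    ring_nf
  simp only [hermiteNormalized, e2, sqrt_factorial_succ n]
  have hr : aeval y (hermite (n + 2)) = y * aeval y (hermite (n + 1)) -
      ((n : ℝ) + 1) * aeval y (hermite n) := by
    rw [hermite_add_two]; simp
  rw [hr]
  have hs : Real.sqrt ((n : ℝ) + 1) ^ 2 = n + 1 := Real.sq_sqrt (by positivity)
  field_simp
  rw [hs]
  ring

/-- The Christoffel–Darboux formula. -/
theorem hermite_christoffelDarboux (n : ℕ) (y z : ℝ) :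
    (y - z) * ∑ ν ∈ Finset.range (n + 1), hermiteNormalized ν y * hermiteNormalized ν z =
      Real.sqrt (n + 1) * (hermiteNormalized (n + 1) y * hermiteNormalized n z -
        hermiteNormalized n y * hermiteNormalized (n + 1) z) := by
  induction n with
  | zero => simp [hermiteNormalized_zero, hermiteNormalized_one]
  | succ n ih =>
    rw [Finset.sum_range_succ, mul_add, ih]
    have hy := sqrt_mul_hermiteNormalized_add_two n y
    have hz := sqrt_mul_hermiteNormalized_add_two n z
    have e : ((n + 1 : ℕ) : ℝ) + 1 = n + 2 := by push_cast; ring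
    rw [e, show n + 1 + 1 = n + 2 from rfl]
    linear_combination hz * hermiteNormalized (n + 1) y - hy * hermiteNormalized (n + 1) z

/-- At `0` the recurrence multiplies the square by `(n+1)/(n+2)` every two steps, and `(n+1)(n+3) ≤
(n+2)²` closes the induction. This is the `n^(-1/4)` decay at the origin, which the energy carries
to other points. -/
theorem hermiteNormalized_zero_sq_mul_le (n : ℕ) :
    hermiteNormalized n 0 ^ 2 * Real.sqrt (n + 1) ≤ 1 := by
  induction n using Nat.strong_induction_on with
  | _ n ih =>
    match n, ih with
    | 0, _ => simp [hermiteNormalized_zero]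
    | 1, _ => simp [hermiteNormalized_one]
    | n + 2, ih =>
      have h := ih n (by omega)
      have hr := sqrt_mul_hermiteNormalized_add_two n 0
      have hr2 : ((n : ℝ) + 2) * hermiteNormalized (n + 2) 0 ^ 2 =
          ((n : ℝ) + 1) * hermiteNormalized n 0 ^ 2 := by
        have := congrArg (· ^ 2) hr
        simp only [zero_mul, zero_sub, neg_sq, mul_pow] at this
        rwa [Real.sq_sqrt (by positivity), Real.sq_sqrt (by positivity)] at this
      have e : hermiteNormalized (n + 2) 0 ^ 2 =
          ((n : ℝ) + 1) / (n + 2) * hermiteNormalized n 0 ^ 2 := by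
        field_simp; linarith
      have hs : (((n : ℝ) + 1) / (n + 2)) * Real.sqrt (n + 3) ≤ Real.sqrt (n + 1) := by
        rw [← abs_of_nonneg (a := ((n : ℝ) + 1) / (n + 2)) (by positivity), ← Real.sqrt_sq_eq_abs,
          ← Real.sqrt_mul (by positivity)]
        apply Real.sqrt_le_sqrt
        rw [div_pow, div_mul_eq_mul_div, div_le_iff₀ (by positivity)]
        nlinarith
      have e3 : ((n + 2 : ℕ) : ℝ) + 1 = n + 3 := by push_cast; ring
      rw [e3, e]
      calc _ = hermiteNormalized n 0 ^ 2 * (((n : ℝ) + 1) / (n + 2) * Real.sqrt (n + 3)) := by ring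
        _ ≤ hermiteNormalized n 0 ^ 2 * Real.sqrt (n + 1) := by gcongr
        _ ≤ 1 := h

/-- Sonin's function for the Hermite differential equation. -/
noncomputable def hermiteEnergy (n : ℕ) (y : ℝ) : ℝ :=
  Real.exp (-y ^ 2 / 2) * (aeval y (derivative (hermite n)) ^ 2 -
    y * aeval y (hermite n) * aeval y (derivative (hermite n)) +
    ((n : ℝ) + 1 / 2) * aeval y (hermite n) ^ 2)

/-- The function `φ = exp(-y²/4) He_n` solves `φ'' + qφ = 0` with `q = n + 1/2 - y²/4`, and the
energy is `φ'² + qφ²`; its derivative is therefore `q'φ²`. -/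
theorem hasDerivAt_hermiteEnergy (n : ℕ) (y : ℝ) :
    HasDerivAt (hermiteEnergy n)
      (-(y / 2) * (aeval y (hermite n) ^ 2 * Real.exp (-y ^ 2 / 2))) y := by
  have hA := hasDerivAt_aeval_int (hermite n) y
  have hD := hasDerivAt_aeval_int (derivative (hermite n)) y
  have hE : HasDerivAt (fun y : ℝ => Real.exp (-y ^ 2 / 2)) (Real.exp (-y ^ 2 / 2) * (-y)) y := by
    have : HasDerivAt (fun y : ℝ => -y ^ 2 / 2) (-y) y := by
      have := ((hasDerivAt_pow 2 y).neg.div_const 2)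
      refine this.congr_deriv ?_
      simp
      ring
    exact this.exp
  have h := hE.mul (((hD.pow 2).sub (((hasDerivAt_id y).mul hA).mul hD)).add
    ((hA.pow 2).const_mul ((n : ℝ) + 1 / 2)))
  refine h.congr_deriv ?_
  rw [derivative_derivative_hermite]
  simp
  ring

theorem hermiteEnergy_le_zero (n : ℕ) (y : ℝ) : hermiteEnergy n y ≤ hermiteEnergy n 0 := by
  have hd : ∀ x, deriv (hermiteEnergy n) x = _ := fun x => (hasDerivAt_hermiteEnergy n x).deriv
  have hc : Continuous (hermiteEnergy n) :=
    continuous_iff_continuousAt.2 fun x => (hasDerivAt_hermiteEnergy n x).continuousAt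
  have hdf : Differentiable ℝ (hermiteEnergy n) :=
    fun x => (hasDerivAt_hermiteEnergy n x).differentiableAt
  rcases le_total 0 y with hy | hy
  · refine antitoneOn_of_deriv_nonpos (convex_Ici (0 : ℝ)) hc.continuousOn hdf.differentiableOn
      (fun x hx => ?_) Set.self_mem_Ici hy hy
    rw [interior_Ici] at hx
    rw [hd]
    have : 0 < x := hx
    exact mul_nonpos_of_nonpos_of_nonneg (by linarith) (by positivity)
  · refine monotoneOn_of_deriv_nonneg (convex_Iic (0 : ℝ)) hc.continuousOn hdf.differentiableOn
      (fun x hx => ?_) hy Set.self_mem_Iic hy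
    rw [interior_Iic] at hx
    rw [hd]
    have : x < 0 := hx
    exact mul_nonneg (by linarith) (by positivity)

/-- At the origin only `He_n'(0)²` and `(n + 1/2) He_n(0)²` remain. Since `He_n' = n He_{n-1}`, the
decay at `0` bounds each by `√(n+1) n!`. -/
theorem hermiteEnergy_zero_le (n : ℕ) :
    hermiteEnergy n 0 ≤ 2 * Real.sqrt (n + 1) * n.factorial := by
  have hA : ∀ m : ℕ, aeval (0 : ℝ) (hermite m) ^ 2 * Real.sqrt (m + 1) ≤ m.factorial := by
    intro m
    rw [← hermiteNormalized_mul_sqrt_factorial, mul_pow, Real.sq_sqrt (by positivity)]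
    have := mul_le_mul_of_nonneg_right (hermiteNormalized_zero_sq_mul_le m)
      (show (0 : ℝ) ≤ m.factorial by positivity)
    linarith
  have h1 : ((n : ℝ) + 1 / 2) * aeval (0 : ℝ) (hermite n) ^ 2 ≤
      Real.sqrt (n + 1) * n.factorial := by
    have hs : Real.sqrt ((n : ℝ) + 1) ^ 2 = n + 1 := Real.sq_sqrt (by positivity)
    calc _ ≤ ((n : ℝ) + 1) * aeval (0 : ℝ) (hermite n) ^ 2 := by gcongr; norm_num
      _ = Real.sqrt (n + 1) * (aeval (0 : ℝ) (hermite n) ^ 2 * Real.sqrt (n + 1)) := by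
          linear_combination (-aeval (0 : ℝ) (hermite n) ^ 2) * hs
      _ ≤ _ := by gcongr; exact hA n
  have h2 : aeval (0 : ℝ) (derivative (hermite n)) ^ 2 ≤ Real.sqrt (n + 1) * n.factorial := by
    cases n with
    | zero => simp
    | succ n =>
      rw [derivative_hermite_succ]
      have hs : Real.sqrt ((n : ℝ) + 1) ^ 2 = n + 1 := Real.sq_sqrt (by positivity)
      have e : aeval (0 : ℝ) (((n : ℤ[X]) + 1) * hermite n) ^ 2 =
          ((n : ℝ) + 1) * Real.sqrt (n + 1) *
            (aeval (0 : ℝ) (hermite n) ^ 2 * Real.sqrt (n + 1)) := by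
        simp only [map_mul, map_add, map_natCast, map_one]
        rw [show ((n : ℝ) + 1) * Real.sqrt (n + 1) *
            (aeval (0 : ℝ) (hermite n) ^ 2 * Real.sqrt (n + 1)) = ((n : ℝ) + 1) *
            Real.sqrt (n + 1) ^ 2 * aeval (0 : ℝ) (hermite n) ^ 2 by ring, hs]
        ring
      rw [e]
      calc _ ≤ ((n : ℝ) + 1) * Real.sqrt (n + 1) * n.factorial := by gcongr; exact hA n
        _ = Real.sqrt (n + 1) * ((n + 1).factorial : ℝ) := by
          rw [Nat.factorial_succ]; push_cast; ring
        _ ≤ _ := by gcongr; linarith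
  simp only [hermiteEnergy]
  simp
  norm_num at h1
  linarith

/-- Completing the square in the energy leaves `(n + 1/2 - y²/4) He_n²`, which is at least `(n+1)/2
· He_n²` when `y² ≤ 2n`. Comparison with the energy at `0` gives the constant `4`. -/
theorem hermiteNormalized_sq_mul_sqrt_le {n : ℕ} {y : ℝ} (hn : y ^ 2 ≤ 2 * n) :
    hermiteNormalized n y ^ 2 * Real.sqrt (n + 1) ≤ 4 * Real.exp (y ^ 2 / 2) := by
  have h := (hermiteEnergy_le_zero n y).trans (hermiteEnergy_zero_le n)
  set A : ℝ := aeval y (hermite n) with hAdef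
  have hA : hermiteNormalized n y ^ 2 * n.factorial = A ^ 2 := by
    rw [hAdef, ← hermiteNormalized_mul_sqrt_factorial, mul_pow, Real.sq_sqrt (by positivity)]
  have h1 : Real.exp (-y ^ 2 / 2) * (((n : ℝ) + 1) / 2 * A ^ 2) ≤ hermiteEnergy n y := by
    unfold hermiteEnergy
    gcongr
    have := sq_nonneg (aeval y (derivative (hermite n)) - y / 2 * A)
    have h3 : 0 ≤ (2 * n - y ^ 2) * A ^ 2 := mul_nonneg (by linarith) (sq_nonneg _)
    nlinarith
  have h2 := h1.trans h
  have he : Real.exp (-y ^ 2 / 2) * Real.exp (y ^ 2 / 2) = 1 := by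
    rw [← Real.exp_add]; simp; ring
  set s := Real.sqrt ((n : ℝ) + 1) with hsdef
  have hs : s ^ 2 = n + 1 := Real.sq_sqrt (by positivity)
  have hs0 : 0 < s := Real.sqrt_pos.2 (by positivity)
  have hf : (0 : ℝ) < n.factorial := by positivity
  have h4 : (hermiteNormalized n y ^ 2 * s) * (s * n.factorial / 2) ≤
      (4 * Real.exp (y ^ 2 / 2)) * (s * n.factorial / 2) := by
    calc _ = (Real.exp (-y ^ 2 / 2) * (((n : ℝ) + 1) / 2 * A ^ 2)) * Real.exp (y ^ 2 / 2) := by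
          rw [← hs, ← hA]
          linear_combination (-s ^ 2 / 2 * hermiteNormalized n y ^ 2 * n.factorial) * he
      _ ≤ (2 * s * n.factorial) * Real.exp (y ^ 2 / 2) := by gcongr
      _ = _ := by ring
  exact le_of_mul_le_mul_right h4 (by positivity)

theorem exists_abs_le_of_eventually {f : ℕ → ℝ} {C : ℝ} (h : ∀ᶠ n in atTop, |f n| ≤ C) :
    ∃ K, ∀ n, |f n| ≤ K := by
  obtain ⟨N, hN⟩ := eventually_atTop.1 h
  refine ⟨|C| + ∑ k ∈ Finset.range N, |f k|, fun n => ?_⟩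
  have hs : 0 ≤ ∑ k ∈ Finset.range N, |f k| := Finset.sum_nonneg fun _ _ => abs_nonneg _
  by_cases hn : n < N
  · have := Finset.single_le_sum (f := fun k => |f k|) (fun _ _ => abs_nonneg _)
      (Finset.mem_range.2 hn)
    have := abs_nonneg C
    linarith
  · have := hN n (by omega)
    have := le_abs_self C
    linarith

theorem exists_sqrt_mul_hermiteNormalized_le (y z : ℝ) :
    ∃ C, ∀ n : ℕ,
      |Real.sqrt (n + 1) * (hermiteNormalized (n + 1) y * hermiteNormalized n z)| ≤ C := by
  refine exists_abs_le_of_eventually (C := Real.sqrt (4 * Real.exp (y ^ 2 / 2) *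
    (4 * Real.exp (z ^ 2 / 2)))) ?_
  obtain ⟨N, hN⟩ := exists_nat_ge (y ^ 2 + z ^ 2)
  filter_upwards [eventually_ge_atTop N] with n hn
  have hn' : (N : ℝ) ≤ n := by exact_mod_cast hn
  have h1 := hermiteNormalized_sq_mul_sqrt_le (n := n + 1) (y := y)
    (by push_cast; nlinarith [sq_nonneg y, sq_nonneg z])
  have h2 := hermiteNormalized_sq_mul_sqrt_le (n := n) (y := z)
    (by nlinarith [sq_nonneg y, sq_nonneg z])
  apply Real.abs_le_sqrt
  have hs : Real.sqrt ((n : ℝ) + 1) ≤ Real.sqrt (((n + 1 : ℕ) : ℝ) + 1) :=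
    Real.sqrt_le_sqrt (by push_cast; linarith)
  calc _ = (hermiteNormalized (n + 1) y ^ 2 * Real.sqrt (n + 1)) *
        (hermiteNormalized n z ^ 2 * Real.sqrt (n + 1)) := by ring
    _ ≤ (hermiteNormalized (n + 1) y ^ 2 * Real.sqrt (((n + 1 : ℕ) : ℝ) + 1)) *
        (hermiteNormalized n z ^ 2 * Real.sqrt (n + 1)) := by gcongr
    _ ≤ _ := by gcongr

/-- The factor `√(n+1)` in Christoffel–Darboux is exactly compensated by two factors of order
`n^(-1/4)`. -/
theorem exists_abs_sum_hermiteNormalized_le {y z : ℝ} (hyz : y ≠ z) :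
    ∃ C, ∀ n : ℕ, |∑ ν ∈ Finset.range n, hermiteNormalized ν y * hermiteNormalized ν z| ≤ C := by
  obtain ⟨C₁, h₁⟩ := exists_sqrt_mul_hermiteNormalized_le y z
  obtain ⟨C₂, h₂⟩ := exists_sqrt_mul_hermiteNormalized_le z y
  have hne : 0 < |y - z| := abs_pos.2 (sub_ne_zero.2 hyz)
  refine ⟨(C₁ + C₂) / |y - z|, fun n => ?_⟩
  cases n with
  | zero =>
    simp only [Finset.range_zero, Finset.sum_empty, abs_zero]
    have := (abs_nonneg _).trans (h₁ 0)
    have := (abs_nonneg _).trans (h₂ 0)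
    positivity
  | succ n =>
    rw [le_div_iff₀ hne, mul_comm, ← abs_mul, hermite_christoffelDarboux, mul_sub]
    refine (abs_sub _ _).trans (add_le_add (h₁ n) ?_)
    rw [mul_comm (hermiteNormalized n y)]
    exact h₂ n

/-- Abel summation: damping a series with bounded partial sums by powers of `r ∈ [0, 1]` keeps the
bound. -/
theorem abs_sum_pow_mul_le {f : ℕ → ℝ} {C : ℝ} (hf : ∀ n, |∑ i ∈ Finset.range n, f i| ≤ C)
    {r : ℝ} (h0 : 0 ≤ r) (h1 : r ≤ 1) (n : ℕ) :
    |∑ i ∈ Finset.range n, r ^ i * f i| ≤ C := by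
  have key : ∀ n, ∑ i ∈ Finset.range n, r ^ i * f i = r ^ n * ∑ i ∈ Finset.range n, f i +
      ∑ i ∈ Finset.range n, (r ^ i - r ^ (i + 1)) * ∑ j ∈ Finset.range (i + 1), f j := by
    intro n
    induction n with
    | zero => simp
    | succ n ih => rw [Finset.sum_range_succ, ih, Finset.sum_range_succ _ n,
        Finset.sum_range_succ (fun i => (r ^ i - r ^ (i + 1)) * _), Finset.sum_range_succ _ n]; ring
  -- The weights `r ^ n` and `r ^ i - r ^ (i + 1)` are nonnegative and telescope to total mass `1`.
  have hd : ∀ i, 0 ≤ r ^ i - r ^ (i + 1) :=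
    fun i => sub_nonneg.2 (pow_le_pow_of_le_one h0 h1 (Nat.le_succ i))
  rw [key]
  calc _ ≤ |r ^ n * ∑ i ∈ Finset.range n, f i| +
        ∑ i ∈ Finset.range n, |(r ^ i - r ^ (i + 1)) * ∑ j ∈ Finset.range (i + 1), f j| :=
        (abs_add_le _ _).trans (add_le_add le_rfl (Finset.abs_sum_le_sum_abs _ _))
    _ ≤ r ^ n * C + ∑ i ∈ Finset.range n, (r ^ i - r ^ (i + 1)) * C := by
        refine add_le_add ?_ (Finset.sum_le_sum fun i _ => ?_)
        · rw [abs_mul, abs_of_nonneg (pow_nonneg h0 n)]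
          exact mul_le_mul_of_nonneg_left (hf n) (pow_nonneg h0 n)
        · rw [abs_mul, abs_of_nonneg (hd i)]
          exact mul_le_mul_of_nonneg_left (hf _) (hd i)
    _ = C := by
        rw [← Finset.sum_mul, Finset.sum_range_sub' (fun i => r ^ i) n]
        ring

theorem hermite_comp_neg (n : ℕ) : (hermite n).comp (-X) = (-1) ^ n * hermite n := by
  induction n using Nat.strong_induction_on with
  | _ n ih =>
    match n, ih with
    | 0, _ => simp
    | 1, _ => simp
    | n + 2, ih =>
      rw [hermite_add_two, sub_comp, mul_comp, mul_comp, ih (n + 1) (by omega), ih n (by omega)]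
      simp
      ring

theorem hermiteNormalized_neg (n : ℕ) (y : ℝ) :
    hermiteNormalized n (-y) = (-1) ^ n * hermiteNormalized n y := by
  have h := congrArg (aeval y) (hermite_comp_neg n)
  rw [aeval_comp] at h
  simp at h
  rw [hermiteNormalized, h, hermiteNormalized, mul_div_assoc]

end Hermite

/-! ### Mehler's formula. -/

section Mehler

open Polynomial

theorem integrable_gaussianReal_iff {E : Type*} [NormedAddCommGroup E] [NormedSpace ℝ E]
    {f : ℝ → E} : Integrable f (gaussianReal 0 1) ↔
      Integrable (fun x => gaussianPDFReal 0 1 x • f x) volume := by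
  rw [gaussianReal_of_var_ne_zero 0 one_ne_zero, integrable_withDensity_iff_integrable_smul'
    (measurable_gaussianPDF 0 1) (ae_of_all _ fun x => gaussianPDF_lt_top)]
  simp only [toReal_gaussianPDF]

theorem integrable_add_I_mul_pow (n : ℕ) (y : ℝ) :
    Integrable (fun z : ℝ => ((y : ℂ) + Complex.I * z) ^ n) (gaussianReal 0 1) := by
  rcases Nat.eq_zero_or_pos n with rfl | hn
  · simp
  have hid : MemLp (fun z : ℝ => (z : ℂ)) n (gaussianReal 0 1) :=
    (memLp_id_gaussianReal (n : NNReal)).ofReal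
  have h : MemLp (fun z : ℝ => (y : ℂ) + Complex.I * z) n (gaussianReal 0 1) :=
    (memLp_const (y : ℂ)).add (hid.const_mul Complex.I)
  have hi := h.integrable_norm_pow hn.ne'
  refine hi.mono' (by fun_prop) (ae_of_all _ fun z => ?_)
  rw [norm_pow]

/-- Gaussian integration by parts for the monomials `(y + i z) ^ (n + 1)`. -/
theorem integral_mul_add_I_mul_pow (n : ℕ) (y : ℝ) :
    ∫ z : ℝ, (z : ℂ) * ((y : ℂ) + Complex.I * z) ^ (n + 1) ∂(gaussianReal 0 1) =
      ((n : ℂ) + 1) * Complex.I *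
        ∫ z : ℝ, ((y : ℂ) + Complex.I * z) ^ n ∂(gaussianReal 0 1) := by
  have i0 := integrable_add_I_mul_pow n y
  have i1 := integrable_add_I_mul_pow (n + 1) y
  have i2 := integrable_add_I_mul_pow (n + 2) y
  -- Substituting `z = i (y - (y + i z))` leaves only powers already known to be integrable.
  have e : ∀ z : ℝ, (z : ℂ) * ((y : ℂ) + Complex.I * z) ^ (n + 1) =
      Complex.I * ((y : ℂ) * ((y : ℂ) + Complex.I * z) ^ (n + 1) -
        ((y : ℂ) + Complex.I * z) ^ (n + 2)) := by
    intro z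
    linear_combination ((z : ℂ) * ((y : ℂ) + Complex.I * z) ^ (n + 1)) * Complex.I_sq
  have i3 : Integrable (fun z : ℝ => (z : ℂ) * ((y : ℂ) + Complex.I * z) ^ (n + 1))
      (gaussianReal 0 1) := by
    simp only [e]
    exact ((i1.const_mul _).sub i2).const_mul _
  have i4 : Integrable (fun z : ℝ => ((n : ℂ) + 1) * Complex.I * ((y : ℂ) + Complex.I * z) ^ n -
      (z : ℂ) * ((y : ℂ) + Complex.I * z) ^ (n + 1)) (gaussianReal 0 1) :=
    (i0.const_mul _).sub i3
  have hpdf : ∀ z, HasDerivAt (gaussianPDFReal 0 1) (gaussianPDFReal 0 1 z * (-z)) z := by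
    intro z
    have h1 : HasDerivAt (fun z : ℝ => -(z - 0) ^ 2 / (2 * ((1 : NNReal) : ℝ))) (-z) z := by
      have := (((hasDerivAt_id z).sub_const 0).pow 2).neg.div_const (2 * ((1 : NNReal) : ℝ))
      refine this.congr_deriv ?_
      simp
      ring
    refine (h1.exp.const_mul _).congr_deriv ?_
    simp [gaussianPDFReal]
    ring
  have hF : ∀ z : ℝ, HasDerivAt
      (fun z : ℝ => gaussianPDFReal 0 1 z • ((y : ℂ) + Complex.I * z) ^ (n + 1))
      (gaussianPDFReal 0 1 z • (((n : ℂ) + 1) * Complex.I * ((y : ℂ) + Complex.I * z) ^ n -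
        (z : ℂ) * ((y : ℂ) + Complex.I * z) ^ (n + 1))) z := by
    intro z
    have h1 : HasDerivAt (fun z : ℝ => ((y : ℂ) + Complex.I * z)) Complex.I z := by
      simpa using ((Complex.ofRealCLM.hasDerivAt (x := z)).const_mul Complex.I).const_add (y : ℂ)
    refine ((hpdf z).smul (h1.pow (n + 1))).congr_deriv ?_
    simp only [Complex.real_smul, Pi.pow_apply]
    push_cast
    simp
    ring
  have h0 := integral_eq_zero_of_hasDerivAt_of_integrable hF
    (integrable_gaussianReal_iff.1 i4) (integrable_gaussianReal_iff.1 i1)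
  rw [← integral_gaussianReal_eq_integral_smul one_ne_zero,
    integral_sub (i0.const_mul _) i3, integral_const_mul] at h0
  exact (sub_eq_zero.1 h0).symm

/-- The Hermite polynomials are Gaussian averages of monomials on vertical lines. -/
theorem integral_add_I_mul_pow (n : ℕ) (y : ℝ) :
    ∫ z : ℝ, ((y : ℂ) + Complex.I * z) ^ n ∂(gaussianReal 0 1) =
      ((aeval y (hermite n) : ℝ) : ℂ) := by
  induction n using Nat.strong_induction_on with
  | _ n ih =>
    match n, ih with
    | 0, _ => simp
    | 1, _ =>
      have h1 : Integrable (fun z : ℝ => Complex.I * (z : ℂ)) (gaussianReal 0 1) := by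
        simpa using integrable_add_I_mul_pow 1 0
      simp only [pow_one]
      have h0 : ∫ z : ℝ, (z : ℂ) ∂(gaussianReal 0 1) = 0 := by
        rw [integral_complex_ofReal]
        simp
      rw [integral_add (integrable_const _) h1, integral_const_mul, h0]
      simp
    | n + 2, ih =>
      have hs := integral_mul_add_I_mul_pow n y
      have e : ∀ z : ℝ, ((y : ℂ) + Complex.I * z) ^ (n + 2) =
          y * ((y : ℂ) + Complex.I * z) ^ (n + 1) +
            Complex.I * ((z : ℂ) * ((y : ℂ) + Complex.I * z) ^ (n + 1)) := fun z => by ring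
      have i1 := integrable_add_I_mul_pow (n + 1) y
      have i3 : Integrable (fun z : ℝ => Complex.I *
          ((z : ℂ) * ((y : ℂ) + Complex.I * z) ^ (n + 1))) (gaussianReal 0 1) := by
        refine ((integrable_add_I_mul_pow (n + 2) y).sub (i1.const_mul (y : ℂ))).congr
          (ae_of_all _ fun z => ?_)
        simp only [Pi.sub_apply]
        ring
      simp only [e]
      rw [integral_add (i1.const_mul _) i3, integral_const_mul, integral_const_mul, hs,
        ih (n + 1) (by omega), ih n (by omega)]
      have hr : aeval y (hermite (n + 2)) = y * aeval y (hermite (n + 1)) -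
          ((n : ℝ) + 1) * aeval y (hermite n) := by
        rw [hermite_add_two]; simp
      rw [hr, Complex.ofReal_sub, Complex.ofReal_mul, Complex.ofReal_mul, Complex.ofReal_add,
        Complex.ofReal_natCast, Complex.ofReal_one]
      linear_combination ((n : ℂ) + 1) * ((aeval y (hermite n) : ℝ) : ℂ) * Complex.I_sq

theorem integrable_exp_mul_sq_gaussianReal {a : ℝ} (ha : a < 1 / 2) :
    Integrable (fun z : ℝ => Real.exp (a * z ^ 2)) (gaussianReal 0 1) := by
  rw [integrable_gaussianReal_iff]
  refine ((integrable_exp_neg_mul_sq (b := 1 / 2 - a) (by linarith)).const_mul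
    (√(2 * Real.pi * ((1 : NNReal) : ℝ)))⁻¹).congr (ae_of_all _ fun z => ?_)
  simp only [gaussianPDFReal, smul_eq_mul, mul_assoc]
  rw [← Real.exp_add]
  congr 2
  simp
  ring

theorem norm_add_I_mul_sq (y z : ℝ) : ‖(y : ℂ) + Complex.I * z‖ ^ 2 = y ^ 2 + z ^ 2 := by
  rw [Complex.sq_norm, Complex.normSq_apply]
  simp
  ring

theorem exp_norm_mul_le (a y₁ y₂ z₁ z₂ : ℝ) (ha : 0 ≤ a) :
    Real.exp (a * (‖(y₁ : ℂ) + Complex.I * z₁‖ * ‖(y₂ : ℂ) + Complex.I * z₂‖)) ≤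
      Real.exp (a * (y₁ ^ 2 + y₂ ^ 2) / 2) *
        (Real.exp (a / 2 * z₁ ^ 2) * Real.exp (a / 2 * z₂ ^ 2)) := by
  rw [← Real.exp_add, ← Real.exp_add]
  apply Real.exp_le_exp.2
  have h1 := norm_add_I_mul_sq y₁ z₁
  have h2 := norm_add_I_mul_sq y₂ z₂
  have h3 := two_mul_le_add_sq ‖(y₁ : ℂ) + Complex.I * z₁‖ ‖(y₂ : ℂ) + Complex.I * z₂‖
  nlinarith

/-- The arithmetic–geometric mean inequality decouples the two variables; `a < 1` makes each factor
`exp (a z² / 2)` integrable against the Gaussian. -/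
theorem integrable_exp_norm_mul {a : ℝ} (h0 : 0 ≤ a) (h1 : a < 1) (y₁ y₂ : ℝ) :
    Integrable (fun p : ℝ × ℝ =>
      Real.exp (a * (‖(y₁ : ℂ) + Complex.I * p.1‖ * ‖(y₂ : ℂ) + Complex.I * p.2‖)))
      ((gaussianReal 0 1).prod (gaussianReal 0 1)) := by
  have hi := integrable_exp_mul_sq_gaussianReal (a := a / 2) (by linarith)
  refine ((hi.mul_prod hi).const_mul (Real.exp (a * (y₁ ^ 2 + y₂ ^ 2) / 2))).mono'
    (by fun_prop) (ae_of_all _ fun p => ?_)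
  rw [Real.norm_of_nonneg (Real.exp_pos _).le]
  exact exp_norm_mul_le a y₁ y₂ p.1 p.2 h0

/-- In the exponential series every term splits into two independent Gaussian averages of monomials,
each a Hermite polynomial. -/
theorem hasSum_mehler_integral {r : ℝ} (hr : |r| < 1) (y₁ y₂ : ℝ) :
    HasSum (fun n : ℕ => ((r ^ n * (hermiteNormalized n y₁ * hermiteNormalized n y₂) : ℝ) : ℂ))
      (∫ p : ℝ × ℝ, Complex.exp ((r : ℂ) * (((y₁ : ℂ) + Complex.I * p.1) *
        ((y₂ : ℂ) + Complex.I * p.2))) ∂((gaussianReal 0 1).prod (gaussianReal 0 1))) := by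
  have hsum : ∀ p : ℝ × ℝ, HasSum (fun n : ℕ => (|r| * (‖(y₁ : ℂ) + Complex.I * p.1‖ *
      ‖(y₂ : ℂ) + Complex.I * p.2‖)) ^ n / (n.factorial : ℝ))
      (Real.exp (|r| * (‖(y₁ : ℂ) + Complex.I * p.1‖ * ‖(y₂ : ℂ) + Complex.I * p.2‖))) := by
    intro p
    rw [Real.exp_eq_exp_ℝ]
    exact NormedSpace.expSeries_div_hasSum_exp _
  have h := hasSum_integral_of_dominated_convergence
    (μ := (gaussianReal 0 1).prod (gaussianReal 0 1))
    (F := fun (n : ℕ) (p : ℝ × ℝ) => ((r : ℂ) * (((y₁ : ℂ) + Complex.I * p.1) *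
        ((y₂ : ℂ) + Complex.I * p.2))) ^ n / (n.factorial : ℂ))
    (f := fun p : ℝ × ℝ => Complex.exp ((r : ℂ) * (((y₁ : ℂ) + Complex.I * p.1) *
        ((y₂ : ℂ) + Complex.I * p.2))))
    (fun n p => (|r| * (‖(y₁ : ℂ) + Complex.I * p.1‖ *
      ‖(y₂ : ℂ) + Complex.I * p.2‖)) ^ n / (n.factorial : ℝ))
    (fun n => by fun_prop)
    (fun n => ae_of_all _ fun p => by simp [norm_pow])
    (ae_of_all _ fun p => (hsum p).summable)
    (by
      simp only [(hsum _).tsum_eq]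
      exact integrable_exp_norm_mul (abs_nonneg r) hr y₁ y₂)
    (ae_of_all _ fun p => by
      rw [Complex.exp_eq_exp_ℂ]
      exact NormedSpace.expSeries_div_hasSum_exp _)
  refine h.congr_fun fun n => ?_
  have e : ∀ p : ℝ × ℝ, ((r : ℂ) * (((y₁ : ℂ) + Complex.I * p.1) *
      ((y₂ : ℂ) + Complex.I * p.2))) ^ n / (n.factorial : ℂ) = (r : ℂ) ^ n / (n.factorial : ℂ) *
      (((y₁ : ℂ) + Complex.I * p.1) ^ n * ((y₂ : ℂ) + Complex.I * p.2) ^ n) := fun p => by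
    rw [mul_pow, mul_pow]
    ring
  simp only [e]
  rw [integral_const_mul, integral_prod_mul (fun z : ℝ => ((y₁ : ℂ) + Complex.I * z) ^ n)
    (fun z : ℝ => ((y₂ : ℂ) + Complex.I * z) ^ n), integral_add_I_mul_pow, integral_add_I_mul_pow,
    ← hermiteNormalized_mul_sqrt_factorial, ← hermiteNormalized_mul_sqrt_factorial]
  have hf : (n.factorial : ℝ) ≠ 0 := by positivity
  have hs : √(n.factorial : ℝ) ^ 2 = n.factorial := Real.sq_sqrt (by positivity)
  norm_cast
  rw [div_mul_eq_mul_div, eq_div_iff hf]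
  linear_combination (-r ^ n * hermiteNormalized n y₁ * hermiteNormalized n y₂) * hs

theorem integral_cexp_mul_gaussianReal (w : ℂ) :
    ∫ z : ℝ, Complex.exp (w * z) ∂(gaussianReal 0 1) = Complex.exp (w ^ 2 / 2) := by
  have h := complexMGF_id_gaussianReal (μ := 0) (v := 1) w
  simpa [complexMGF] using h

/-- The first variable enters the exponent linearly and is integrated by the complex moment
generating function; what remains is a one-dimensional Gaussian integral. -/
theorem integral_mehler {r : ℝ} (hr : |r| < 1) (y₁ y₂ : ℝ) :
    ∫ p : ℝ × ℝ, Complex.exp ((r : ℂ) * (((y₁ : ℂ) + Complex.I * p.1) *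
        ((y₂ : ℂ) + Complex.I * p.2))) ∂((gaussianReal 0 1).prod (gaussianReal 0 1)) =
      (((√(1 - r ^ 2))⁻¹ * Real.exp (r * y₁ * y₂ - r ^ 2 * y₂ ^ 2 / 2 -
        r ^ 2 * (y₁ - r * y₂) ^ 2 / (2 * (1 - r ^ 2))) : ℝ) : ℂ) := by
  have hr2 : 0 < 1 - r ^ 2 := by
    have := (sq_lt_one_iff_abs_lt_one r).2 hr
    linarith
  have hint : Integrable (fun p : ℝ × ℝ => Complex.exp ((r : ℂ) * (((y₁ : ℂ) + Complex.I * p.1) *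
        ((y₂ : ℂ) + Complex.I * p.2)))) ((gaussianReal 0 1).prod (gaussianReal 0 1)) := by
    refine (integrable_exp_norm_mul (abs_nonneg r) hr y₁ y₂).mono' (by fun_prop)
      (ae_of_all _ fun p => ?_)
    refine (Complex.norm_exp_le_exp_norm _).trans_eq ?_
    simp
  rw [integral_prod_symm _ hint]
  have hin : ∀ z : ℝ, ∫ x : ℝ, Complex.exp ((r : ℂ) * (((y₁ : ℂ) + Complex.I * x) *
        ((y₂ : ℂ) + Complex.I * z))) ∂(gaussianReal 0 1) =
      Complex.exp ((r : ℂ) * y₁ * ((y₂ : ℂ) + Complex.I * z) -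
        (r : ℂ) ^ 2 * ((y₂ : ℂ) + Complex.I * z) ^ 2 / 2) := by
    intro z
    have e : ∀ x : ℝ, Complex.exp ((r : ℂ) * (((y₁ : ℂ) + Complex.I * x) *
        ((y₂ : ℂ) + Complex.I * z))) = Complex.exp ((r : ℂ) * y₁ * ((y₂ : ℂ) + Complex.I * z)) *
        Complex.exp ((r * Complex.I * ((y₂ : ℂ) + Complex.I * z)) * x) := by
      intro x
      rw [← Complex.exp_add]
      congr 1
      ring
    simp only [e]
    rw [integral_const_mul, integral_cexp_mul_gaussianReal, ← Complex.exp_add]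
    congr 1
    linear_combination (r : ℂ) ^ 2 * ((y₂ : ℂ) + Complex.I * z) ^ 2 / 2 * Complex.I_sq
  simp only [hin]
  rw [integral_gaussianReal_eq_integral_smul one_ne_zero]
  -- The density contributes `-z²/2` and the first integration `+r²z²/2`, so the quadratic
  -- coefficient is negative precisely because `|r| < 1`.
  have e : ∀ z : ℝ, gaussianPDFReal 0 1 z • Complex.exp ((r : ℂ) * y₁ *
      ((y₂ : ℂ) + Complex.I * z) - (r : ℂ) ^ 2 * ((y₂ : ℂ) + Complex.I * z) ^ 2 / 2) =
      (((√(2 * Real.pi))⁻¹ : ℝ) : ℂ) * Complex.exp (((-((1 - r ^ 2) / 2) : ℝ) : ℂ) * (z : ℂ) ^ 2 +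
        (Complex.I * ((r * y₁ - r ^ 2 * y₂ : ℝ) : ℂ)) * z +
        ((r * y₁ * y₂ - r ^ 2 * y₂ ^ 2 / 2 : ℝ) : ℂ)) := by
    intro z
    rw [gaussianPDFReal, Complex.real_smul, Complex.ofReal_mul, Complex.ofReal_exp, mul_assoc,
      ← Complex.exp_add]
    congr 2
    · simp
    · push_cast
      simp
      linear_combination (-(r : ℂ) ^ 2 * (z : ℂ) ^ 2 / 2) * Complex.I_sq
  simp only [e]
  rw [integral_const_mul, integral_cexp_quadratic (by rw [Complex.ofReal_re]; linarith)]
  have hsq : (((Real.pi : ℂ) / -((-((1 - r ^ 2) / 2) : ℝ) : ℂ)) ^ (1 / 2 : ℂ)) =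
      ((√(2 * Real.pi / (1 - r ^ 2)) : ℝ) : ℂ) := by
    rw [Real.sqrt_eq_rpow, Complex.ofReal_cpow (by positivity)]
    congr 1
    · push_cast
      field_simp
    · simp
  rw [hsq]
  have hex : ((r * y₁ * y₂ - r ^ 2 * y₂ ^ 2 / 2 : ℝ) : ℂ) -
      (Complex.I * ((r * y₁ - r ^ 2 * y₂ : ℝ) : ℂ)) ^ 2 / (4 * ((-((1 - r ^ 2) / 2) : ℝ) : ℂ)) =
      ((r * y₁ * y₂ - r ^ 2 * y₂ ^ 2 / 2 -
        r ^ 2 * (y₁ - r * y₂) ^ 2 / (2 * (1 - r ^ 2)) : ℝ) : ℂ) := by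
    rw [mul_pow, Complex.I_sq, neg_one_mul]
    norm_cast
    field_simp
    ring
  rw [hex, ← Complex.ofReal_exp]
  norm_cast
  rw [← mul_assoc]
  congr 1
  rw [Real.sqrt_div (by positivity)]
  have : √(2 * Real.pi) ≠ 0 := by positivity
  field_simp

/-- The density of the standard bivariate Gaussian law with correlation `r`. -/
noncomputable def mehlerKernel (r y z : ℝ) : ℝ :=
  gaussianPDFReal 0 1 y * gaussianPDFReal (r * y) (1 - r ^ 2).toNNReal z

/-- The last factor is kept in the unsymmetric form that `integral_mehler` produces. -/
theorem mehlerKernel_eq {r : ℝ} (hr : |r| < 1) (y z : ℝ) :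
    mehlerKernel r y z = gaussianPDFReal 0 1 y * gaussianPDFReal 0 1 z *
      ((√(1 - r ^ 2))⁻¹ * Real.exp (r * y * z - r ^ 2 * z ^ 2 / 2 -
        r ^ 2 * (y - r * z) ^ 2 / (2 * (1 - r ^ 2)))) := by
  have hr2 : 0 < 1 - r ^ 2 := by
    have := (sq_lt_one_iff_abs_lt_one r).2 hr
    linarith
  simp only [mehlerKernel, gaussianPDFReal, Real.coe_toNNReal _ hr2.le]
  rw [Real.sqrt_mul (by positivity) (1 - r ^ 2), mul_inv]
  have h : ∀ a b c d : ℝ, a * b * (a * c * d) = a * a * c * (b * d) := fun a b c d => by ring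
  have h' : ∀ a b c d e : ℝ, a * b * (a * c) * (d * e) = a * a * d * (b * c * e) :=
    fun a b c d e => by ring
  simp only [NNReal.coe_one, mul_one, sub_zero]
  rw [h, h', ← Real.exp_add, ← Real.exp_add, ← Real.exp_add]
  congr 2
  field_simp
  ring

/-- Mehler's formula. -/
theorem hasSum_mehlerKernel {r : ℝ} (hr : |r| < 1) (y z : ℝ) :
    HasSum (fun n : ℕ => gaussianPDFReal 0 1 y * gaussianPDFReal 0 1 z *
      (r ^ n * (hermiteNormalized n y * hermiteNormalized n z))) (mehlerKernel r y z) := by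
  have h := hasSum_mehler_integral hr y z
  rw [integral_mehler hr] at h
  rw [mehlerKernel_eq hr]
  exact (Complex.hasSum_ofReal.1 h).mul_left _

end Mehler

/-! ### Averaging Mehler's series over the correlation. -/

section MehlerMixture

theorem mehlerKernel_nonneg (r y z : ℝ) : 0 ≤ mehlerKernel r y z :=
  mul_nonneg (gaussianPDFReal_nonneg _ _ _) (gaussianPDFReal_nonneg _ _ _)

theorem mehlerKernel_neg (r y z : ℝ) : mehlerKernel (-r) y z = mehlerKernel r (-y) z := by
  simp [mehlerKernel, gaussianPDFReal]

theorem measurable_mehlerKernel :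
    Measurable fun p : ℝ × ℝ × ℝ => mehlerKernel p.1 p.2.1 p.2.2 := by
  unfold mehlerKernel gaussianPDFReal
  fun_prop

theorem measurable_mehlerKernel_left (y z : ℝ) : Measurable fun r => mehlerKernel r y z := by
  unfold mehlerKernel gaussianPDFReal
  fun_prop

theorem gaussianPDFReal_zero_neg (y : ℝ) :
    gaussianPDFReal 0 1 (-y) = gaussianPDFReal 0 1 y := by
  simp [gaussianPDFReal]

/-- The partial sums of Mehler's series. -/
noncomputable def mehlerPartialSum (n : ℕ) (y z r : ℝ) : ℝ :=
  ∑ ν ∈ Finset.range n, gaussianPDFReal 0 1 y * gaussianPDFReal 0 1 z *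
    (r ^ ν * (hermiteNormalized ν y * hermiteNormalized ν z))

theorem tendsto_mehlerPartialSum {r : ℝ} (hr : |r| < 1) (y z : ℝ) :
    Tendsto (fun n => mehlerPartialSum n y z r) atTop (𝓝 (mehlerKernel r y z)) :=
  (hasSum_mehlerKernel hr y z).tendsto_sum_nat

theorem measurable_mehlerPartialSum (n : ℕ) (y z : ℝ) : Measurable (mehlerPartialSum n y z) := by
  unfold mehlerPartialSum
  fun_prop

theorem exists_abs_mehlerPartialSum_le {y z : ℝ} (hyz : y ≠ z) :
    ∃ C, ∀ n r, 0 ≤ r → r ≤ 1 → |mehlerPartialSum n y z r| ≤ C := by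
  obtain ⟨C, hC⟩ := exists_abs_sum_hermiteNormalized_le hyz
  refine ⟨|gaussianPDFReal 0 1 y * gaussianPDFReal 0 1 z| * C, fun n r h0 h1 => ?_⟩
  rw [mehlerPartialSum, ← Finset.mul_sum, abs_mul]
  exact mul_le_mul_of_nonneg_left (abs_sum_pow_mul_le hC h0 h1 n) (abs_nonneg _)

theorem integrable_pow_of_abs_lt_one {μ : Measure ℝ} [IsFiniteMeasure μ]
    (hμ : ∀ᵐ r ∂μ, |r| < 1) (n : ℕ) : Integrable (fun r => r ^ n) μ := by
  refine Integrable.of_bound (C := 1) (by fun_prop) ?_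
  filter_upwards [hμ] with r hr
  rw [norm_pow]
  exact pow_le_one₀ (norm_nonneg r) hr.le

theorem integral_mehlerPartialSum {μ : Measure ℝ} [IsFiniteMeasure μ]
    (hμ : ∀ᵐ r ∂μ, |r| < 1) (n : ℕ) (y z : ℝ) :
    ∫ r, mehlerPartialSum n y z r ∂μ = gaussianPDFReal 0 1 y * gaussianPDFReal 0 1 z *
      ∑ ν ∈ Finset.range n, (∫ r, r ^ ν ∂μ) * hermiteNormalized ν y * hermiteNormalized ν z := by
  unfold mehlerPartialSum
  rw [integral_finsetSum _ fun ν _ =>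
    ((integrable_pow_of_abs_lt_one hμ ν).mul_const _).const_mul _, Finset.mul_sum]
  refine Finset.sum_congr rfl fun ν _ => ?_
  rw [integral_const_mul, integral_mul_const, mul_assoc (∫ r, r ^ ν ∂μ)]

/-- The partial sums have one bound for all `r` in `[0, 1]`. It dominates the convergence and, in
the limit, bounds the kernel, so the mixed density is finite. -/
theorem tendsto_integral_mehlerPartialSum_of_ne {μ : Measure ℝ} [IsFiniteMeasure μ]
    (hμ : ∀ᵐ r ∂μ, 0 ≤ r ∧ r < 1) {y z : ℝ} (hyz : y ≠ z) :
    ∫⁻ r, ENNReal.ofReal (mehlerKernel r y z) ∂μ ≠ ⊤ ∧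
    Tendsto (fun n => ∫ r, mehlerPartialSum n y z r ∂μ) atTop
      (𝓝 (∫⁻ r, ENNReal.ofReal (mehlerKernel r y z) ∂μ).toReal) := by
  obtain ⟨C, hC⟩ := exists_abs_mehlerPartialSum_le hyz
  have hlim : ∀ᵐ r ∂μ, Tendsto (fun n => mehlerPartialSum n y z r) atTop
      (𝓝 (mehlerKernel r y z)) := by
    filter_upwards [hμ] with r hr
    exact tendsto_mehlerPartialSum (abs_lt.2 ⟨by linarith [hr.1], hr.2⟩) y z
  have hbd : ∀ n, ∀ᵐ r ∂μ, ‖mehlerPartialSum n y z r‖ ≤ C := fun n => by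
    filter_upwards [hμ] with r hr
    exact hC n r hr.1 hr.2.le
  have hint : Integrable (fun r => mehlerKernel r y z) μ := by
    refine Integrable.of_bound (C := C) ?_ ?_
    · exact (measurable_mehlerKernel_left y z).aestronglyMeasurable
    · filter_upwards [hlim, ae_all_iff.2 hbd] with r h1 h2
      exact le_of_tendsto h1.norm (Eventually.of_forall h2)
  have hl := tendsto_integral_of_dominated_convergence (fun _ => C)
    (fun n => (measurable_mehlerPartialSum n y z).aestronglyMeasurable) (integrable_const C) hbd hlim
  have he := ofReal_integral_eq_lintegral_ofReal hint (ae_of_all _ fun r => mehlerKernel_nonneg r y z)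
  rw [← he, ENNReal.toReal_ofReal (integral_nonneg fun r => mehlerKernel_nonneg r y z)]
  exact ⟨ENNReal.ofReal_ne_top, hl⟩

/-- On the diagonal with `r ≥ 0` the terms are nonnegative, so sum and integral commute
unconditionally; the common value may be infinite, hence `EReal`. -/
theorem tendsto_integral_mehlerPartialSum_self {μ : Measure ℝ} [IsFiniteMeasure μ]
    (hμ : ∀ᵐ r ∂μ, 0 ≤ r ∧ r < 1) (y : ℝ) :
    Tendsto (fun n => ((∫ r, mehlerPartialSum n y y r ∂μ : ℝ) : EReal)) atTop
      (𝓝 ((∫⁻ r, ENNReal.ofReal (mehlerKernel r y y) ∂μ : ℝ≥0∞) : EReal)) := by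
  have hμ' : ∀ᵐ r ∂μ, |r| < 1 := by
    filter_upwards [hμ] with r hr
    exact abs_lt.2 ⟨by linarith [hr.1], hr.2⟩
  set c : ℝ := gaussianPDFReal 0 1 y * gaussianPDFReal 0 1 y with hc
  have hc0 : 0 ≤ c := mul_self_nonneg _
  have hterm : ∀ r, 0 ≤ r → ∀ ν : ℕ,
      0 ≤ c * (r ^ ν * (hermiteNormalized ν y * hermiteNormalized ν y)) := fun r hr ν =>
    mul_nonneg hc0 (mul_nonneg (pow_nonneg hr ν) (mul_self_nonneg _))
  have hsum : ∀ n, ((∫ r, mehlerPartialSum n y y r ∂μ : ℝ) : EReal) =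
      ((∑ ν ∈ Finset.range n, ∫⁻ r, ENNReal.ofReal
        (c * (r ^ ν * (hermiteNormalized ν y * hermiteNormalized ν y))) ∂μ : ℝ≥0∞) : EReal) := by
    intro n
    have hint : Integrable (mehlerPartialSum n y y) μ := by
      unfold mehlerPartialSum
      exact integrable_finsetSum _ fun ν _ =>
        ((integrable_pow_of_abs_lt_one hμ' ν).mul_const _).const_mul _
    have hnn : 0 ≤ᵐ[μ] mehlerPartialSum n y y := by
      filter_upwards [hμ] with r hr
      exact Finset.sum_nonneg fun ν _ => hterm r hr.1 ν
    rw [← lintegral_finsetSum _ fun ν _ => by fun_prop]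
    have : ∫⁻ r, ∑ ν ∈ Finset.range n, ENNReal.ofReal
        (c * (r ^ ν * (hermiteNormalized ν y * hermiteNormalized ν y))) ∂μ =
        ENNReal.ofReal (∫ r, mehlerPartialSum n y y r ∂μ) := by
      rw [ofReal_integral_eq_lintegral_ofReal hint hnn]
      refine lintegral_congr_ae ?_
      filter_upwards [hμ] with r hr
      rw [mehlerPartialSum, ENNReal.ofReal_sum_of_nonneg fun ν _ => hterm r hr.1 ν]
    rw [this, EReal.coe_ennreal_ofReal, max_eq_left (integral_nonneg_of_ae hnn)]
  have hl : ∫⁻ r, ENNReal.ofReal (mehlerKernel r y y) ∂μ = ∑' ν : ℕ, ∫⁻ r, ENNReal.ofReal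
        (c * (r ^ ν * (hermiteNormalized ν y * hermiteNormalized ν y))) ∂μ := by
    rw [← lintegral_tsum fun ν => by fun_prop]
    refine lintegral_congr_ae ?_
    filter_upwards [hμ, hμ'] with r hr hr'
    have h := hasSum_mehlerKernel hr' y y
    rw [← h.tsum_eq, ENNReal.ofReal_tsum_of_nonneg (hterm r hr.1) h.summable]
  simp only [hsum]
  rw [hl]
  exact (continuous_coe_ennreal_ereal.tendsto _).comp (ENNReal.tendsto_nat_tsum _)

theorem tendsto_integral_mehlerPartialSum_of_nonneg {μ : Measure ℝ} [IsFiniteMeasure μ]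
    (hμ : ∀ᵐ r ∂μ, 0 ≤ r ∧ r < 1) (y z : ℝ) :
    Tendsto (fun n => ((∫ r, mehlerPartialSum n y z r ∂μ : ℝ) : EReal)) atTop
      (𝓝 ((∫⁻ r, ENNReal.ofReal (mehlerKernel r y z) ∂μ : ℝ≥0∞) : EReal)) := by
  rcases eq_or_ne y z with rfl | hyz
  · exact tendsto_integral_mehlerPartialSum_self hμ y
  · obtain ⟨hfin, hl⟩ := tendsto_integral_mehlerPartialSum_of_ne hμ hyz
    rw [← EReal.coe_toReal (x := ((∫⁻ r, ENNReal.ofReal (mehlerKernel r y z) ∂μ : ℝ≥0∞) : EReal))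
      (by simpa using hfin) (by simp), EReal.toReal_coe_ennreal]
    exact EReal.tendsto_coe.2 hl

/-- Parity of the Hermite polynomials moves the sign of `r` to `y`. -/
theorem mehlerPartialSum_neg (n : ℕ) (y z r : ℝ) :
    mehlerPartialSum n y z (-r) = mehlerPartialSum n (-y) z r := by
  unfold mehlerPartialSum
  refine Finset.sum_congr rfl fun ν _ => ?_
  rw [hermiteNormalized_neg, gaussianPDFReal_zero_neg, neg_pow]
  ring

/-- Splitting an integral at the origin and reflecting the negative half line. -/
theorem lintegral_split_at_zero (μ : Measure ℝ) {f : ℝ → ℝ≥0∞} (hf : Measurable f) :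
    ∫⁻ r, f r ∂μ = ∫⁻ r, f r ∂(μ.restrict (Set.Ici 0)) +
      ∫⁻ r, f (-r) ∂((μ.restrict (Set.Iio 0)).map Neg.neg) := by
  rw [lintegral_map (by fun_prop) measurable_neg]
  simp only [neg_neg]
  rw [← lintegral_add_compl f (measurableSet_Ici (a := (0 : ℝ))), Set.compl_Ici]

theorem integral_split_at_zero {μ : Measure ℝ} {f : ℝ → ℝ} (hf : Measurable f)
    (hi : Integrable f μ) :
    ∫ r, f r ∂μ = ∫ r, f r ∂(μ.restrict (Set.Ici 0)) +
      ∫ r, f (-r) ∂((μ.restrict (Set.Iio 0)).map Neg.neg) := by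
  rw [integral_map (f := fun r => f (-r)) measurable_neg.aemeasurable
    (hf.comp measurable_neg).aestronglyMeasurable]
  simp only [neg_neg]
  rw [← integral_add_compl (measurableSet_Ici (a := (0 : ℝ))) hi, Set.compl_Ici]

section Split

variable {μ : Measure ℝ}

theorem ae_restrict_Ici_of_abs_lt_one (hμ : ∀ᵐ r ∂μ, |r| < 1) :
    ∀ᵐ r ∂(μ.restrict (Set.Ici 0)), 0 ≤ r ∧ r < 1 := by
  filter_upwards [ae_restrict_of_ae hμ, ae_restrict_mem measurableSet_Ici] with r h1 h2
  exact ⟨h2, (abs_lt.1 h1).2⟩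

theorem ae_map_neg_restrict_Iio_of_abs_lt_one (hμ : ∀ᵐ r ∂μ, |r| < 1) :
    ∀ᵐ r ∂((μ.restrict (Set.Iio 0)).map Neg.neg), 0 ≤ r ∧ r < 1 := by
  rw [ae_map_iff measurable_neg.aemeasurable (p := fun r : ℝ => 0 ≤ r ∧ r < 1)
    ((measurableSet_Ici (a := (0 : ℝ))).inter measurableSet_Iio)]
  filter_upwards [ae_restrict_of_ae hμ, ae_restrict_mem measurableSet_Iio] with r h1 h2
  have h2' : r < 0 := h2
  exact ⟨by linarith, by linarith [(abs_lt.1 h1).1]⟩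

theorem lintegral_mehlerKernel_split (y z : ℝ) :
    ∫⁻ r, ENNReal.ofReal (mehlerKernel r y z) ∂μ =
      ∫⁻ r, ENNReal.ofReal (mehlerKernel r y z) ∂(μ.restrict (Set.Ici 0)) +
      ∫⁻ r, ENNReal.ofReal (mehlerKernel r (-y) z) ∂((μ.restrict (Set.Iio 0)).map Neg.neg) := by
  rw [lintegral_split_at_zero μ (measurable_mehlerKernel_left y z).ennreal_ofReal]
  simp only [mehlerKernel_neg]

variable [IsFiniteMeasure μ]

/-- The nonnegative correlations need `y ≠ z`, the reflected negative ones `-y ≠ z`. -/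
theorem lintegral_mehlerKernel_ne_top (hμ : ∀ᵐ r ∂μ, |r| < 1) {y z : ℝ} (hyz : |y| ≠ |z|) :
    ∫⁻ r, ENNReal.ofReal (mehlerKernel r y z) ∂μ ≠ ⊤ := by
  rw [lintegral_mehlerKernel_split]
  refine ENNReal.add_ne_top.2 ⟨?_, ?_⟩
  · exact (tendsto_integral_mehlerPartialSum_of_ne (ae_restrict_Ici_of_abs_lt_one hμ)
      (fun h => hyz (by rw [h]))).1
  · exact (tendsto_integral_mehlerPartialSum_of_ne (ae_map_neg_restrict_Iio_of_abs_lt_one hμ)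
      (fun h => hyz (by rw [← h, abs_neg]))).1

/-- The isofactorial expansion of a mixture of bivariate Gaussian densities, at every point. -/
theorem tendsto_isofactorial_mixture (hμ : ∀ᵐ r ∂μ, |r| < 1) (y z : ℝ) :
    Tendsto (fun n => ((gaussianPDFReal 0 1 y * gaussianPDFReal 0 1 z *
      ∑ ν ∈ Finset.range n, (∫ r, r ^ ν ∂μ) * hermiteNormalized ν y * hermiteNormalized ν z : ℝ) :
        EReal)) atTop
      (𝓝 ((∫⁻ r, ENNReal.ofReal (mehlerKernel r y z) ∂μ : ℝ≥0∞) : EReal)) := by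
  have h1 := tendsto_integral_mehlerPartialSum_of_nonneg (ae_restrict_Ici_of_abs_lt_one hμ) y z
  have h2 := tendsto_integral_mehlerPartialSum_of_nonneg
    (ae_map_neg_restrict_Iio_of_abs_lt_one hμ) (-y) z
  -- Neither limit is `-∞`, so `∞ - ∞` cannot occur and addition is continuous there.
  have hadd := (EReal.continuousAt_add (p := (_, _)) (Or.inr (EReal.coe_ennreal_ne_bot _))
    (Or.inl (EReal.coe_ennreal_ne_bot _))).tendsto.comp (h1.prodMk_nhds h2)
  rw [lintegral_mehlerKernel_split, EReal.coe_ennreal_add]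
  refine hadd.congr fun n => ?_
  have hint : Integrable (mehlerPartialSum n y z) μ := by
    unfold mehlerPartialSum
    exact integrable_finsetSum _ fun ν _ =>
      ((integrable_pow_of_abs_lt_one hμ ν).mul_const _).const_mul _
  rw [← integral_mehlerPartialSum hμ,
    integral_split_at_zero (measurable_mehlerPartialSum n y z) hint]
  simp only [mehlerPartialSum_neg, Function.comp_apply, EReal.coe_add]

end Split

end MehlerMixture

/-! ### Standard bivariate Gaussian laws and their mixtures. -/

section BivariateGaussian

open Matrix

theorem posSemidef_correlation {r : ℝ} (hr : |r| ≤ 1) :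
    (!![1, r; r, 1] : Matrix (Fin 2) (Fin 2) ℝ).PosSemidef := by
  refine Matrix.PosSemidef.of_dotProduct_mulVec_nonneg ?_ fun x => ?_
  · ext i j
    fin_cases i <;> fin_cases j <;> simp
  · obtain ⟨h1, h2⟩ := abs_le.1 hr
    simp [Matrix.mulVec, dotProduct, Fin.sum_univ_two]
    -- The form equals `(1+r)/2 · (x₀+x₁)² + (1-r)/2 · (x₀-x₁)²`.
    nlinarith [mul_nonneg (by linarith : 0 ≤ 1 + r) (sq_nonneg (x 0 + x 1)),
      mul_nonneg (by linarith : 0 ≤ 1 - r) (sq_nonneg (x 0 - x 1))]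

/-- Two normalized linear combinations of a pair of independent standard Gaussian variables form a
standard bivariate Gaussian vector. -/
theorem map_linear_gaussianReal_prod {a b c d : ℝ} (h₁ : a ^ 2 + b ^ 2 = 1)
    (h₂ : c ^ 2 + d ^ 2 = 1) :
    ((gaussianReal 0 1).prod (gaussianReal 0 1)).map
      (fun p : ℝ × ℝ => (a * p.1 + b * p.2, c * p.1 + d * p.2)) =
      bivariateGaussian (a * c + b * d) := by
  have hr : |a * c + b * d| ≤ 1 := by
    rw [← sq_le_one_iff_abs_le_one]
    -- Lagrange's identity: `(ac + bd)² + (ad - bc)² = 1`.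
    nlinarith [sq_nonneg (a * d - b * c)]
  have key : multivariateGaussian (0 : EuclideanSpace ℝ (Fin 2))
      !![1, a * c + b * d; a * c + b * d, 1] =
      ((gaussianReal 0 1).prod (gaussianReal 0 1)).map
        (fun p : ℝ × ℝ => !₂[a * p.1 + b * p.2, c * p.1 + d * p.2]) := by
    have hm : Measurable (fun p : ℝ × ℝ =>
        (!₂[a * p.1 + b * p.2, c * p.1 + d * p.2] : EuclideanSpace ℝ (Fin 2))) := by
      refine (WithLp.measurable_toLp 2 _).comp (measurable_pi_lambda _ fun i => ?_)
      fin_cases i <;> simp <;> fun_prop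
    have : IsProbabilityMeasure (((gaussianReal 0 1).prod (gaussianReal 0 1)).map
        (fun p : ℝ × ℝ => (!₂[a * p.1 + b * p.2, c * p.1 + d * p.2] :
          EuclideanSpace ℝ (Fin 2)))) := Measure.isProbabilityMeasure_map hm.aemeasurable
    apply Measure.ext_of_charFun
    ext t
    rw [charFun_multivariateGaussian (posSemidef_correlation hr), charFun_apply,
      integral_map hm.aemeasurable (by fun_prop)]
    have e : ∀ p : ℝ × ℝ, Complex.exp (((inner ℝ (!₂[a * p.1 + b * p.2, c * p.1 + d * p.2] :
        EuclideanSpace ℝ (Fin 2)) t : ℝ) : ℂ) * Complex.I) =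
        Complex.exp (((t 0 * a + t 1 * c : ℝ) : ℂ) * p.1 * Complex.I) *
        Complex.exp (((t 0 * b + t 1 * d : ℝ) : ℂ) * p.2 * Complex.I) := by
      intro p
      rw [← Complex.exp_add]
      congr 1
      simp [PiLp.inner_apply, Fin.sum_univ_two]
      ring
    simp only [e]
    rw [integral_prod_mul (fun x : ℝ => Complex.exp (((t 0 * a + t 1 * c : ℝ) : ℂ) * x * Complex.I))
      (fun x : ℝ => Complex.exp (((t 0 * b + t 1 * d : ℝ) : ℂ) * x * Complex.I)),
      ← charFun_apply_real, ← charFun_apply_real, charFun_gaussianReal, charFun_gaussianReal,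
      ← Complex.exp_add]
    congr 1
    have e1 : ((a : ℂ)) ^ 2 + b ^ 2 = 1 := by exact_mod_cast h₁
    have e2 : ((c : ℂ)) ^ 2 + d ^ 2 = 1 := by exact_mod_cast h₂
    simp [Matrix.mulVec, dotProduct, Fin.sum_univ_two]
    linear_combination ((t 0 : ℂ) ^ 2 / 2) * e1 + ((t 1 : ℂ) ^ 2 / 2) * e2
  rw [bivariateGaussian, key, Measure.map_map (by fun_prop) ?_]
  · rfl
  · refine (WithLp.measurable_toLp 2 _).comp (measurable_pi_lambda _ fun i => ?_)
    fin_cases i <;> simp <;> fun_prop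

theorem bivariateGaussian_eq_map {r : ℝ} (hr : |r| ≤ 1) :
    bivariateGaussian r = ((gaussianReal 0 1).prod (gaussianReal 0 1)).map
      (fun p : ℝ × ℝ => (p.1, r * p.1 + √(1 - r ^ 2) * p.2)) := by
  have h := map_linear_gaussianReal_prod (a := 1) (b := 0) (c := r) (d := √(1 - r ^ 2)) (by simp)
    (by
      rw [Real.sq_sqrt]
      · ring
      · linarith [(sq_le_one_iff_abs_le_one r).2 hr])
  simpa using h.symm

theorem map_fst_bivariateGaussian {r : ℝ} (hr : |r| ≤ 1) :
    (bivariateGaussian r).map Prod.fst = gaussianReal 0 1 := by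
  rw [bivariateGaussian_eq_map hr, Measure.map_map (by fun_prop) (by fun_prop)]
  exact Measure.fst_prod

/-- The explicit pushforward is measurable in every `r`, but it is identified with the Gaussian law
only where the matrix is positive semidefinite. -/
theorem aemeasurable_bivariateGaussian {μ : Measure ℝ} (hμ : ∀ᵐ r ∂μ, |r| ≤ 1) :
    AEMeasurable bivariateGaussian μ := by
  refine ⟨fun r => ((gaussianReal 0 1).prod (gaussianReal 0 1)).map
      (fun p : ℝ × ℝ => (p.1, r * p.1 + √(1 - r ^ 2) * p.2)), ?_, ?_⟩
  · refine Measure.measurable_of_measurable_coe _ fun s hs => ?_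
    have hm : Measurable fun q : ℝ × ℝ × ℝ =>
        (q.2.1, q.1 * q.2.1 + √(1 - q.1 ^ 2) * q.2.2) := by fun_prop
    have h := measurable_measure_prodMk_left (ν := (gaussianReal 0 1).prod (gaussianReal 0 1))
      (hm hs)
    convert! h using 2 with r
    rw [Measure.map_apply (by fun_prop) hs]
    rfl
  · filter_upwards [hμ] with r hr
    exact bivariateGaussian_eq_map hr

theorem measurable_mehlerKernel_right (r : ℝ) :
    Measurable fun p : ℝ × ℝ => mehlerKernel r p.1 p.2 := by
  unfold mehlerKernel gaussianPDFReal
  fun_prop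

/-- Given the first coordinate `x`, the second is Gaussian with mean `r x` and variance `1 - r²`,
nonzero here. -/
theorem bivariateGaussian_eq_withDensity {r : ℝ} (hr : |r| < 1) :
    bivariateGaussian r = (volume : Measure (ℝ × ℝ)).withDensity
      (fun p => ENNReal.ofReal (mehlerKernel r p.1 p.2)) := by
  have hr2 : 0 < 1 - r ^ 2 := by linarith [(sq_lt_one_iff_abs_lt_one r).2 hr]
  have hv : (1 - r ^ 2).toNNReal ≠ 0 := by simpa using hr2
  have hmk := measurable_mehlerKernel_right r
  refine Measure.ext_of_lintegral _ fun f hf => ?_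
  rw [bivariateGaussian_eq_map hr.le, lintegral_map hf (by fun_prop),
    lintegral_prod _ (by fun_prop), lintegral_withDensity_eq_lintegral_mul _ hmk.ennreal_ofReal hf,
    Measure.volume_eq_prod, lintegral_prod _ (by fun_prop),
    gaussianReal_of_var_ne_zero 0 one_ne_zero, lintegral_withDensity_eq_lintegral_mul _
      (measurable_gaussianPDF 0 1) (by fun_prop), ← gaussianReal_of_var_ne_zero 0 one_ne_zero]
  refine lintegral_congr fun x => ?_
  have hmap : (gaussianReal 0 1).map (fun z => r * x + √(1 - r ^ 2) * z) =
      gaussianReal (r * x) (1 - r ^ 2).toNNReal := by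
    have : (fun z => r * x + √(1 - r ^ 2) * z) = (fun z => r * x + z) ∘
      (fun z => √(1 - r ^ 2) * z) := rfl
    rw [this, ← Measure.map_map (by fun_prop) (by fun_prop), gaussianReal_map_const_mul,
      gaussianReal_map_const_add]
    congr 1
    · simp
    · ext
      simp [Real.sq_sqrt hr2.le, hr2.le]
  have h1 : ∫⁻ z, f (x, r * x + √(1 - r ^ 2) * z) ∂(gaussianReal 0 1) =
      ∫⁻ z, gaussianPDF (r * x) (1 - r ^ 2).toNNReal z * f (x, z) := by
    rw [← lintegral_map (μ := gaussianReal 0 1) (f := fun z => f (x, z)) (by fun_prop) (by fun_prop),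
      hmap, gaussianReal_of_var_ne_zero _ hv,
      lintegral_withDensity_eq_lintegral_mul _ (measurable_gaussianPDF _ _) (by fun_prop)]
    rfl
  simp only [Pi.mul_apply, h1]
  rw [← lintegral_const_mul _ (by fun_prop)]
  refine lintegral_congr fun z => ?_
  rw [mehlerKernel, ENNReal.ofReal_mul (gaussianPDFReal_nonneg _ _ _), mul_assoc]
  rfl

/-- A mixture of nondegenerate standard bivariate Gaussian laws has the mixed density. -/
theorem bind_bivariateGaussian_eq_withDensity {μ : Measure ℝ} [SFinite μ]
    (hμ : ∀ᵐ r ∂μ, |r| < 1) :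
    μ.bind bivariateGaussian = (volume : Measure (ℝ × ℝ)).withDensity
      (fun p => ∫⁻ r, ENNReal.ofReal (mehlerKernel r p.1 p.2) ∂μ) := by
  have hk : Measurable fun q : ℝ × ℝ × ℝ => ENNReal.ofReal (mehlerKernel q.1 q.2.1 q.2.2) :=
    measurable_mehlerKernel.ennreal_ofReal
  ext s hs
  rw [Measure.bind_apply hs (aemeasurable_bivariateGaussian (hμ.mono fun r hr => hr.le)),
    withDensity_apply _ hs, lintegral_lintegral_swap
      (f := fun (p : ℝ × ℝ) r => ENNReal.ofReal (mehlerKernel r p.1 p.2))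
      (hk.comp (measurable_snd.prodMk measurable_fst)).aemeasurable]
  refine lintegral_congr_ae ?_
  filter_upwards [hμ] with r hr
  rw [bivariateGaussian_eq_withDensity hr, withDensity_apply _ hs]

end BivariateGaussian

/-! ### The Box–Muller transform. -/

section BoxMuller

theorem gaussianPDF_mul_gaussianPDF_polar (r θ : ℝ) :
    gaussianPDF 0 1 (r * Real.cos θ) * gaussianPDF 0 1 (r * Real.sin θ) =
      (ENNReal.ofReal (2 * Real.pi))⁻¹ * ENNReal.ofReal (Real.exp (-r ^ 2 / 2)) := by
  have hπ : 0 < 2 * Real.pi := by positivity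
  rw [gaussianPDF, gaussianPDF, ← ENNReal.ofReal_mul (gaussianPDFReal_nonneg _ _ _),
    ← ENNReal.ofReal_inv_of_pos hπ, ← ENNReal.ofReal_mul (by positivity)]
  congr 1
  simp only [gaussianPDFReal, NNReal.coe_one, mul_one, sub_zero]
  have h : ∀ a b c : ℝ, a * b * (a * c) = a * a * (b * c) := fun a b c => by ring
  rw [h, ← Real.exp_add, ← mul_inv, Real.mul_self_sqrt hπ.le]
  congr 2
  linear_combination (-r ^ 2 / 2) * Real.sin_sq_add_cos_sq θ

theorem lintegral_gaussianReal_prod_polar {f : ℝ × ℝ → ℝ≥0∞} (hf : Measurable f) :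
    ENNReal.ofReal (2 * Real.pi) * ∫⁻ p, f p ∂((gaussianReal 0 1).prod (gaussianReal 0 1)) =
      ∫⁻ r in Set.Ioi (0 : ℝ), ∫⁻ θ in Set.Ioo 0 (2 * Real.pi),
        ENNReal.ofReal (r * Real.exp (-r ^ 2 / 2)) * f (r * Real.cos θ, r * Real.sin θ) := by
  have hm := measurable_gaussianPDF 0 1
  -- The polar chart has angles in `(-π, π)`. Reflection through the origin, harmless by symmetry,
  -- turns into the shift by `π` that carries them onto `(0, 2π)`.
  have h1 : ∫⁻ p, f p ∂((gaussianReal 0 1).prod (gaussianReal 0 1)) =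
      ∫⁻ p : ℝ × ℝ, gaussianPDF 0 1 p.1 * gaussianPDF 0 1 p.2 * f (-p.1, -p.2) := by
    rw [gaussianReal_of_var_ne_zero 0 one_ne_zero, prod_withDensity hm hm,
      lintegral_withDensity_eq_lintegral_mul _ (by fun_prop) hf, ← Measure.volume_eq_prod,
      ← lintegral_neg_eq_self]
    refine lintegral_congr fun p => ?_
    simp [gaussianPDF, gaussianPDFReal_zero_neg]
    rfl
  have hshift : ∀ g : ℝ → ℝ≥0∞, ∫⁻ θ in Set.Ioo (-Real.pi) Real.pi, g (θ + Real.pi) =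
      ∫⁻ θ in Set.Ioo 0 (2 * Real.pi), g θ := by
    intro g
    rw [← (measurePreserving_add_right volume Real.pi).setLIntegral_comp_preimage_emb
      (MeasurableEquiv.addRight Real.pi).measurableEmbedding g (Set.Ioo 0 (2 * Real.pi))]
    congr 2
    ext x
    simp only [Set.mem_preimage, Set.mem_Ioo]
    constructor <;> rintro ⟨h, h'⟩ <;> constructor <;> linarith
  rw [h1, ← lintegral_comp_polarCoord_symm, polarCoord_target, Measure.volume_eq_prod,
    setLIntegral_prod _ (by simp only [polarCoord_symm_apply]; fun_prop),
    ← lintegral_const_mul' _ _ ENNReal.ofReal_ne_top]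
  refine setLIntegral_congr_fun measurableSet_Ioi fun r hr => ?_
  have hr0 : 0 < r := hr
  rw [← lintegral_const_mul' _ _ ENNReal.ofReal_ne_top, ← hshift]
  refine lintegral_congr fun θ => ?_
  have hπ : ENNReal.ofReal (2 * Real.pi) ≠ 0 := by simp [Real.pi_pos]
  simp only [polarCoord_symm_apply, Real.cos_add_pi, Real.sin_add_pi, mul_neg, smul_eq_mul]
  rw [gaussianPDF_mul_gaussianPDF_polar, ENNReal.ofReal_mul hr0.le]
  set A := ENNReal.ofReal (2 * Real.pi)
  calc _ = (A * A⁻¹) * (ENNReal.ofReal r * ENNReal.ofReal (Real.exp (-r ^ 2 / 2)) *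
        f (-(r * Real.cos θ), -(r * Real.sin θ))) := by ring
    _ = _ := by rw [ENNReal.mul_inv_cancel hπ ENNReal.ofReal_ne_top, one_mul]

theorem image_exp_neg_sq_half : (fun r : ℝ => Real.exp (-r ^ 2 / 2)) '' Set.Ioi 0 = Set.Ioo 0 1 := by
  ext v
  constructor
  · rintro ⟨r, hr, rfl⟩
    have hr0 : 0 < r := hr
    have : 0 < r ^ 2 := by positivity
    exact ⟨Real.exp_pos _, Real.exp_zero ▸ Real.exp_lt_exp.2 (by linarith)⟩
  · rintro ⟨h0, h1⟩
    have hl : 0 < -2 * Real.log v := by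
      have := Real.log_neg h0 h1
      linarith
    refine ⟨√(-2 * Real.log v), Real.sqrt_pos.2 hl, ?_⟩
    simp only
    rw [Real.sq_sqrt hl.le, show -(-2 * Real.log v) / 2 = Real.log v by ring, Real.exp_log h0]

/-- The Box–Muller transform of a pair of uniform variables. -/
theorem lintegral_boxMuller {f : ℝ × ℝ → ℝ≥0∞} (hf : Measurable f) :
    ∫⁻ v in Set.Ioo (0 : ℝ) 1, ∫⁻ θ in Set.Ioo 0 (2 * Real.pi),
      f (√(-2 * Real.log v) * Real.cos θ, √(-2 * Real.log v) * Real.sin θ) =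
    ENNReal.ofReal (2 * Real.pi) *
      ∫⁻ p, f p ∂((gaussianReal 0 1).prod (gaussianReal 0 1)) := by
  have hderiv : ∀ r ∈ Set.Ioi (0 : ℝ), HasDerivWithinAt (fun r : ℝ => Real.exp (-r ^ 2 / 2))
      (-(r * Real.exp (-r ^ 2 / 2))) (Set.Ioi 0) r := by
    intro r _
    have h : HasDerivAt (fun r : ℝ => -r ^ 2 / 2) (-r) r := by
      refine ((hasDerivAt_pow 2 r).neg.div_const 2).congr_deriv ?_
      simp
      ring
    exact (h.exp.congr_deriv (by ring)).hasDerivWithinAt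
  have hinj : Set.InjOn (fun r : ℝ => Real.exp (-r ^ 2 / 2)) (Set.Ioi 0) := by
    intro r hr s hs h
    have h' := Real.exp_injective h
    have : r ^ 2 = s ^ 2 := by linarith
    exact (pow_left_inj₀ (le_of_lt hr) (le_of_lt hs) two_ne_zero).1 this
  -- Under `v = exp (-r²/2)` the Jacobian is the radial density `r exp (-r²/2)`.
  rw [lintegral_gaussianReal_prod_polar hf, ← image_exp_neg_sq_half,
    lintegral_image_eq_lintegral_abs_deriv_mul measurableSet_Ioi hderiv hinj]
  refine setLIntegral_congr_fun measurableSet_Ioi fun r hr => ?_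
  have hr0 : 0 < r := hr
  have hs : √(-2 * Real.log (Real.exp (-r ^ 2 / 2))) = r := by
    rw [Real.log_exp, show -2 * (-r ^ 2 / 2) = r ^ 2 by ring, Real.sqrt_sq hr0.le]
  simp only [hs]
  rw [abs_neg, abs_of_pos (by positivity), lintegral_const_mul' _ _ ENNReal.ofReal_ne_top]

/-- By the addition formula both coordinates are projections of one Box–Muller pair, on the unit
vectors `(cos α, -sin α)` and `(cos β, -sin β)`, whose inner product is `cos (α - β)`. -/
theorem lintegral_boxMuller_pair {f : ℝ × ℝ → ℝ≥0∞} (hf : Measurable f) (α β : ℝ) :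
    ∫⁻ v in Set.Ioo (0 : ℝ) 1, ∫⁻ θ in Set.Ioo 0 (2 * Real.pi),
      f (√(-2 * Real.log v) * Real.cos (α + θ), √(-2 * Real.log v) * Real.cos (β + θ)) =
    ENNReal.ofReal (2 * Real.pi) * ∫⁻ p, f p ∂(bivariateGaussian (Real.cos (α - β))) := by
  have h := map_linear_gaussianReal_prod (a := Real.cos α) (b := -Real.sin α) (c := Real.cos β)
    (d := -Real.sin β) (by simp) (by simp)
  rw [neg_mul_neg, ← Real.cos_sub] at h
  rw [← h, lintegral_map hf (by fun_prop), ← lintegral_boxMuller (by fun_prop)]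
  refine lintegral_congr fun v => lintegral_congr fun θ => ?_
  congr 2 <;> rw [Real.cos_add] <;> ring

end BoxMuller

/-! ### Pair laws of the spectral field. -/

section SpectralField

variable {Ω : Type*} [MeasurableSpace Ω] {P : Measure Ω}

theorem map_eq_smul_restrict_of_isUniform_Ioo {X : Ω → ℝ} {a b : ℝ}
    (hX : pdf.IsUniform X (Set.Ioo a b) P) :
    P.map X = (ENNReal.ofReal (b - a))⁻¹ • volume.restrict (Set.Ioo a b) := by
  have h : P.map X = ProbabilityTheory.cond volume (Set.Ioo a b) := hX
  rw [h, ProbabilityTheory.cond, Real.volume_Ioo]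

theorem abs_le_one_ae_corrLaw (F : Measure ℝ) (d : ℝ) : ∀ᵐ r ∂(corrLaw F d), |r| ≤ 1 := by
  rw [corrLaw, ae_map_iff (by fun_prop) (measurableSet_le (by fun_prop) (by fun_prop))]
  exact ae_of_all _ fun p => Real.abs_cos_le_one _

/-- A measurable version of the integral against the bivariate Gaussian law. -/
theorem exists_measurable_lintegral_bivariateGaussian {f : ℝ × ℝ → ℝ≥0∞} (hf : Measurable f) :
    ∃ Φ : ℝ → ℝ≥0∞, Measurable Φ ∧ ∀ r, |r| ≤ 1 → ∫⁻ p, f p ∂(bivariateGaussian r) = Φ r := by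
  refine ⟨fun r => ∫⁻ p : ℝ × ℝ, f (p.1, r * p.1 + √(1 - r ^ 2) * p.2)
    ∂((gaussianReal 0 1).prod (gaussianReal 0 1)), ?_, fun r hr => ?_⟩
  · exact Measurable.lintegral_prod_right'
      (f := fun q : ℝ × ℝ × ℝ => f (q.2.1, q.1 * q.2.1 + √(1 - q.1 ^ 2) * q.2.2)) (by fun_prop)
  · rw [bivariateGaussian_eq_map hr, lintegral_map hf (by fun_prop)]

/-- The bivariate laws of the spectral field are mixtures of bivariate Gaussian laws, as soon as
the increment of the underlying field is centred Gaussian. -/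
theorem map_spectral_pair_eq_bind [IsProbabilityMeasure P] {F : Measure ℝ} [IsProbabilityMeasure F]
    {X : Ω → ℝ × ℝ} {V Λ W : Ω → ℝ} (hXm : Measurable X) (hVm : Measurable V) (hΛm : Measurable Λ)
    (hWm : Measurable W) (hV : pdf.IsUniform V (Set.Ioo 0 1) P)
    (hΛ : pdf.IsUniform Λ (Set.Ioo 0 (2 * Real.pi)) P) (hW : P.map W = F)
    (hXW : IndepFun X W P) (hVΛ : IndepFun V Λ P)
    (hpair : IndepFun (fun ω => (X ω, W ω)) (fun ω => (V ω, Λ ω)) P)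
    {d : ℝ} (hd : 0 ≤ d)
    (hX : P.map (fun ω => (X ω).1 - (X ω).2) = gaussianReal 0 d.toNNReal) :
    P.map (fun ω => (√(-2 * Real.log (V ω)) * Real.cos ((X ω).1 * W ω + Λ ω),
      √(-2 * Real.log (V ω)) * Real.cos ((X ω).2 * W ω + Λ ω))) =
      (corrLaw F d).bind bivariateGaussian := by
  have hjoint : P.map (fun ω => ((X ω, W ω), (V ω, Λ ω))) =
      ((P.map X).prod F).prod ((P.map V).prod (P.map Λ)) := by
    rw [hpair.map_prod_eq_prod_map_map (by fun_prop) (by fun_prop),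
      hXW.map_prod_eq_prod_map_map (by fun_prop) (by fun_prop),
      hVΛ.map_prod_eq_prod_map_map (by fun_prop) (by fun_prop), hW]
  have hXp : IsProbabilityMeasure (P.map X) := Measure.isProbabilityMeasure_map (by fun_prop)
  have hVp : IsProbabilityMeasure (P.map V) := Measure.isProbabilityMeasure_map (by fun_prop)
  have hΛp : IsProbabilityMeasure (P.map Λ) := Measure.isProbabilityMeasure_map (by fun_prop)
  have hae := abs_le_one_ae_corrLaw F d
  refine Measure.ext_of_lintegral _ fun f hf => ?_
  obtain ⟨Φ, hΦm, hΦ⟩ := exists_measurable_lintegral_bivariateGaussian hf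
  have hπ : ENNReal.ofReal (2 * Real.pi) ≠ 0 := by simp [Real.pi_pos]
  -- With the field and `W` frozen, integrating out `V` and `Λ` leaves only the phase difference.
  have hinner : ∀ q : (ℝ × ℝ) × ℝ, ∫⁻ s, f (√(-2 * Real.log s.1) * Real.cos (q.1.1 * q.2 + s.2),
      √(-2 * Real.log s.1) * Real.cos (q.1.2 * q.2 + s.2)) ∂((P.map V).prod (P.map Λ)) =
      Φ (Real.cos ((q.1.1 - q.1.2) * q.2)) := by
    intro q
    rw [lintegral_prod _ (by fun_prop), map_eq_smul_restrict_of_isUniform_Ioo hV,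
      map_eq_smul_restrict_of_isUniform_Ioo hΛ]
    simp only [lintegral_smul_measure, sub_zero, smul_eq_mul]
    rw [lintegral_const_mul' _ _ (by simpa using hπ), lintegral_boxMuller_pair hf,
      ← sub_mul, hΦ _ (Real.abs_cos_le_one _), ← mul_assoc, ← mul_assoc,
      mul_assoc _ _ (ENNReal.ofReal (2 * Real.pi)),
      ENNReal.inv_mul_cancel hπ ENNReal.ofReal_ne_top]
    simp
  have hlhs : ∫⁻ p, f p ∂(P.map (fun ω => (√(-2 * Real.log (V ω)) *
        Real.cos ((X ω).1 * W ω + Λ ω), √(-2 * Real.log (V ω)) *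
        Real.cos ((X ω).2 * W ω + Λ ω)))) =
      ∫⁻ q : (ℝ × ℝ) × ℝ, Φ (Real.cos ((q.1.1 - q.1.2) * q.2)) ∂((P.map X).prod F) := by
    rw [lintegral_map hf (by fun_prop)]
    have := lintegral_map (μ := P) (f := fun t : ((ℝ × ℝ) × ℝ) × (ℝ × ℝ) =>
      f (√(-2 * Real.log t.2.1) * Real.cos (t.1.1.1 * t.1.2 + t.2.2),
        √(-2 * Real.log t.2.1) * Real.cos (t.1.1.2 * t.1.2 + t.2.2)))
      (g := fun ω => ((X ω, W ω), (V ω, Λ ω))) (by fun_prop) (by fun_prop)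
    rw [← this, hjoint, lintegral_prod _ (by fun_prop)]
    exact lintegral_congr hinner
  -- This includes `d = 0`, where both sides are the Dirac mass at `0`; coinciding points need no
  -- separate case.
  have hdiff : (P.map X).map (fun x : ℝ × ℝ => x.1 - x.2) =
      (gaussianReal 0 1).map (fun z => √d * z) := by
    rw [Measure.map_map (by fun_prop) hXm, gaussianReal_map_const_mul]
    refine Eq.trans hX ?_
    congr 1
    · simp
    · ext
      simp [Real.sq_sqrt hd, hd]
  rw [hlhs, Measure.lintegral_bind (aemeasurable_bivariateGaussian hae) hf.aemeasurable,
    lintegral_congr_ae (hae.mono hΦ), corrLaw, lintegral_map hΦm (by fun_prop),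
    lintegral_prod_symm _ (by fun_prop), lintegral_prod _ (by fun_prop)]
  have e : ∀ w, ∫⁻ x : ℝ × ℝ, Φ (Real.cos ((x.1 - x.2) * w)) ∂(P.map X) =
      ∫⁻ z, Φ (Real.cos (w * z * √d)) ∂(gaussianReal 0 1) := by
    intro w
    rw [← lintegral_map (f := fun t => Φ (Real.cos (t * w))) (g := fun x : ℝ × ℝ => x.1 - x.2)
      (by fun_prop) (by fun_prop), hdiff, lintegral_map (by fun_prop) (by fun_prop)]
    refine lintegral_congr fun z => ?_
    congr 2
    ring
  exact lintegral_congr e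

/-- The correlation is almost surely nondegenerate when the spectral law has no atom at `0`. -/
theorem abs_lt_one_ae_corrLaw {F : Measure ℝ} [IsProbabilityMeasure F] (hF : F {0} = 0) {d : ℝ}
    (hd : 0 < d) : ∀ᵐ r ∂(corrLaw F d), |r| < 1 := by
  have hms : MeasurableSet {p : ℝ × ℝ | |Real.cos (p.1 * p.2 * √d)| < 1} :=
    measurableSet_lt (by fun_prop) (by fun_prop)
  rw [corrLaw, ae_map_iff (by fun_prop) (measurableSet_lt (by fun_prop) (by fun_prop)),
    Measure.ae_prod_iff_ae_ae hms]
  have hF' : ∀ᵐ w ∂F, w ≠ 0 := by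
    rw [ae_iff]
    simpa using hF
  filter_upwards [hF'] with w hw
  have hc : w * √d ≠ 0 := mul_ne_zero hw (Real.sqrt_ne_zero'.2 hd)
  have := nullSingletonClass_gaussianReal (μ := 0) one_ne_zero
  -- For `w ≠ 0`, `|cos (w z √d)| = 1` only for countably many `z`, a Gaussian null set.
  have hcount : (Set.range fun n : ℤ => (n : ℝ) * Real.pi / (w * √d)).Countable :=
    Set.countable_range _
  filter_upwards [hcount.ae_notMem (gaussianReal 0 1)] with z hz
  refine lt_of_le_of_ne (Real.abs_cos_le_one _) fun h => hz ?_
  have hs : Real.sin (w * z * √d) = 0 := by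
    have h2 := Real.sin_sq_add_cos_sq (w * z * √d)
    rw [← sq_abs (Real.cos _), h] at h2
    simpa using h2
  obtain ⟨n, hn⟩ := Real.sin_eq_zero_iff.1 hs
  refine ⟨n, ?_⟩
  simp only
  rw [hn]
  field_simp

end SpectralField

/-! ### Gaussian increments and Brownian bridges. -/

section IncrementsGeneral

variable {Ω : Type*} [MeasurableSpace Ω] {P : Measure Ω}

theorem hasGaussianLaw_const_real [IsProbabilityMeasure P] (c : ℝ) :
    HasGaussianLaw (fun _ : Ω => c) P := by
  constructor
  rw [Measure.map_const, measure_univ, one_smul]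
  infer_instance

theorem variance_fun_sub_eq [IsFiniteMeasure P] {X Y : Ω → ℝ} (hX : MemLp X 2 P)
    (hY : MemLp Y 2 P) :
    Var[fun ω => X ω - Y ω; P] = cov[X, X; P] - 2 * cov[X, Y; P] + cov[Y, Y; P] := by
  rw [← covariance_self (X := fun ω => X ω - Y ω) (hX.sub hY).aestronglyMeasurable.aemeasurable]
  refine (covariance_fun_sub_fun_sub hX hY hX hY).trans ?_
  rw [covariance_comm Y X]
  ring

theorem IsBrownianBridge.hasGaussianLaw {a b : ℝ} {B : Set.Icc a b → Ω → ℝ}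
    (h : IsBrownianBridge B P) (t : Set.Icc a b) : HasGaussianLaw (B t) P := by
  obtain ⟨-, hB, -, -, -⟩ := h
  exact hB.hasGaussianLaw_eval t

theorem IsBrownianBridge.hasGaussianLaw_sub {a b : ℝ} {B : Set.Icc a b → Ω → ℝ}
    (h : IsBrownianBridge B P) (s t : Set.Icc a b) :
    HasGaussianLaw (fun ω => B s ω - B t ω) P := by
  obtain ⟨-, hB, -, -, -⟩ := h
  exact hB.hasGaussianLaw_fun_sub

theorem IsBrownianBridge.memLp {a b : ℝ} {B : Set.Icc a b → Ω → ℝ} (h : IsBrownianBridge B P)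
    (t : Set.Icc a b) : MemLp (B t) 2 P :=
  (h.hasGaussianLaw t).memLp_two

theorem IsBrownianBridge.variance_pos {a b : ℝ} {B : Set.Icc a b → Ω → ℝ}
    (h : IsBrownianBridge B P) {t : Set.Icc a b} (ht : (t : ℝ) ∈ Set.Ioo a b) :
    0 < cov[B t, B t; P] := by
  rw [h.covariance_eq, min_self, max_self]
  have h1 : 0 < (t : ℝ) - a := sub_pos.2 ht.1
  have h2 : 0 < b - (t : ℝ) := sub_pos.2 ht.2
  have h3 : 0 < b - a := by linarith
  positivity

/-- The variance is `δ (ℓ - δ) / ℓ` with `δ = |t - s|` and `ℓ = b - a`, and `0 < δ < ℓ` for distinct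
interior points. -/
theorem IsBrownianBridge.variance_sub_pos [IsFiniteMeasure P] {a b : ℝ} {B : Set.Icc a b → Ω → ℝ}
    (h : IsBrownianBridge B P) {s t : Set.Icc a b} (hs : (s : ℝ) ∈ Set.Ioo a b)
    (ht : (t : ℝ) ∈ Set.Ioo a b) (hst : (s : ℝ) ≠ t) :
    0 < Var[fun ω => B s ω - B t ω; P] := by
  rw [variance_fun_sub_eq (h.memLp s) (h.memLp t)]
  simp only [h.covariance_eq, min_self, max_self]
  obtain ⟨s, hs'⟩ := s
  obtain ⟨t, ht'⟩ := t
  simp only at hs ht hst ⊢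
  have h3 : 0 < b - a := by linarith [hs.1, hs.2]
  rw [← mul_div_assoc, ← sub_div, ← add_div]
  apply div_pos _ h3
  rcases lt_or_gt_of_ne hst with hlt | hlt
  · rw [min_eq_left hlt.le, max_eq_right hlt.le]
    have : 0 < (t - s) * ((b - a) - (t - s)) :=
      mul_pos (by linarith) (by linarith [hs.1, ht.2])
    nlinarith
  · rw [min_eq_right hlt.le, max_eq_left hlt.le]
    have : 0 < (s - t) * ((b - a) - (s - t)) :=
      mul_pos (by linarith) (by linarith [ht.1, hs.2])
    nlinarith

end IncrementsGeneral

/-! ### Positive definiteness of the modified Laplacian. -/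

namespace EuclideanEdgeGraph

section Laplacian

open Matrix

variable {Vert : Type*} (G : EuclideanEdgeGraph Vert)

theorem length_pos (e : G.graph.edgeSet) : 0 < G.length e := sub_pos.2 (G.lower_lt_upper e)

theorem conductance_comm (u v : Vert) : G.conductance u v = G.conductance v u := by
  unfold conductance
  by_cases h : G.graph.Adj u v
  · rw [dif_pos h, dif_pos h.symm]
    congr 3
    exact Sym2.eq_swap
  · rw [dif_neg h, dif_neg fun h' => h h'.symm]

theorem conductance_nonneg (u v : Vert) : 0 ≤ G.conductance u v := by
  unfold conductance
  split_ifs with h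
  · exact one_div_nonneg.2 (G.length_pos _).le
  · exact le_rfl

theorem conductance_pos {u v : Vert} (h : G.graph.Adj u v) : 0 < G.conductance u v := by
  unfold conductance
  rw [dif_pos h]
  exact one_div_pos.2 (G.length_pos _)

theorem conductance_self (u : Vert) : G.conductance u u = 0 := by
  unfold conductance
  rw [dif_neg (G.graph.loopless.irrefl u)]

variable [Fintype Vert] [DecidableEq Vert] (u₀ : Vert)

theorem modLaplacian_mulVec (x : Vert → ℝ) (u : Vert) :
    (G.modLaplacian u₀ *ᵥ x) u =
      (if u = u₀ then x u else 0) + ∑ w, G.conductance u w * (x u - x w) := by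
  have h : ∀ w, G.modLaplacian u₀ u w * x w = (if u = w then
      ((if u = u₀ then 1 else 0) + ∑ w, G.conductance u w) * x u else 0) -
      G.conductance u w * x w := by
    intro w
    by_cases huw : u = w
    · subst huw
      by_cases hu : u = u₀ <;> simp [modLaplacian, hu, conductance_self]
    · simp [modLaplacian, huw]
  simp only [mulVec, dotProduct, h, Finset.sum_sub_distrib, mul_sub, ← Finset.sum_mul]
  rw [Finset.sum_ite_eq Finset.univ u]
  split_ifs <;> simp_all
  ring

/-- Dirichlet form: symmetrizing over ordered pairs counts every edge twice, hence the division by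
`2`. -/
theorem dotProduct_modLaplacian_mulVec (x : Vert → ℝ) :
    x ⬝ᵥ (G.modLaplacian u₀ *ᵥ x) =
      x u₀ ^ 2 + (∑ u, ∑ w, G.conductance u w * (x u - x w) ^ 2) / 2 := by
  have h1 : x ⬝ᵥ (G.modLaplacian u₀ *ᵥ x) =
      x u₀ ^ 2 + ∑ u, ∑ w, G.conductance u w * (x u * (x u - x w)) := by
    simp only [dotProduct, modLaplacian_mulVec, mul_add, Finset.sum_add_distrib, Finset.mul_sum]
    congr 1
    · simp [sq]
    · exact Finset.sum_congr rfl fun u _ => Finset.sum_congr rfl fun w _ => by ring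
  have h2 : ∑ u, ∑ w, G.conductance u w * (x u * (x u - x w)) =
      ∑ u, ∑ w, G.conductance u w * (x w * (x w - x u)) := by
    rw [Finset.sum_comm]
    exact Finset.sum_congr rfl fun u _ => Finset.sum_congr rfl fun w _ => by
      rw [conductance_comm]
  have h3 : ∑ u, ∑ w, G.conductance u w * (x u - x w) ^ 2 =
      ∑ u, ∑ w, G.conductance u w * (x u * (x u - x w)) +
      ∑ u, ∑ w, G.conductance u w * (x w * (x w - x u)) := by
    simp only [← Finset.sum_add_distrib]
    exact Finset.sum_congr rfl fun u _ => Finset.sum_congr rfl fun w _ => by ring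
  rw [h1, h3, ← h2]
  ring

/-- Zero energy makes `x` constant along edges, hence constant by connectedness; the extra term at
`u₀` makes this constant zero. -/
theorem posDef_modLaplacian : (G.modLaplacian u₀).PosDef := by
  refine Matrix.PosDef.of_dotProduct_mulVec_pos ?_ fun x hx => ?_
  · ext u v
    by_cases huv : u = v
    · subst huv
      simp [modLaplacian]
    · simp [modLaplacian, huv, Ne.symm huv, G.conductance_comm v u]
  · rw [star_trivial, dotProduct_modLaplacian_mulVec]
    have hterm : ∀ u w, 0 ≤ G.conductance u w * (x u - x w) ^ 2 := fun u w =>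
      mul_nonneg (G.conductance_nonneg u w) (sq_nonneg _)
    have hS : 0 ≤ ∑ u, ∑ w, G.conductance u w * (x u - x w) ^ 2 :=
      Finset.sum_nonneg fun u _ => Finset.sum_nonneg fun w _ => hterm u w
    refine lt_of_le_of_ne (by positivity) fun h => hx ?_
    have h0 : x u₀ = 0 := by nlinarith [sq_nonneg (x u₀)]
    have hS0 : ∑ u, ∑ w, G.conductance u w * (x u - x w) ^ 2 = 0 := by
      nlinarith [sq_nonneg (x u₀)]
    have hadj : ∀ u w, G.graph.Adj u w → x u = x w := by
      intro u w huw
      have h1 := (Finset.sum_eq_zero_iff_of_nonneg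
        fun u _ => Finset.sum_nonneg fun w _ => hterm u w).1 hS0 u (Finset.mem_univ u)
      have h2 := (Finset.sum_eq_zero_iff_of_nonneg fun w _ => hterm u w).1 h1 w (Finset.mem_univ w)
      rcases mul_eq_zero.1 h2 with h3 | h3
      · exact absurd h3 (G.conductance_pos huw).ne'
      · exact sub_eq_zero.1 (pow_eq_zero_iff two_ne_zero |>.1 h3)
    have hreach : ∀ u w, G.graph.Reachable u w → x u = x w := by
      rintro u w ⟨p⟩
      induction p with
      | nil => rfl
      | cons hab _ ih => exact (hadj _ _ hab).trans ih
    ext u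
    rw [hreach u u₀ (G.connected.preconnected u u₀), h0]
    rfl

end Laplacian

/-! ### The bridge part of the auxiliary field. -/

section Bridges

variable {Vert : Type*} (G : EuclideanEdgeGraph Vert)

/-- The value at a point of the bridges, as a function of the collection of all paths. -/
def bridgeEval : G.Point → (∀ e : G.graph.edgeSet, G.Interval e → ℝ) → ℝ
  | Sum.inl _, _ => 0
  | Sum.inr ⟨e, x⟩, p => p e ⟨G.chart e x, Set.Ioo_subset_Icc_self (G.chart e x).2⟩

theorem measurable_bridgeEval (u : G.Point) : Measurable (G.bridgeEval u) := by
  rcases u with v | ⟨e, x⟩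
  · exact measurable_const
  · exact (measurable_pi_apply _).comp (measurable_pi_apply e)

theorem bridgeSum_eq_bridgeEval {Ω : Type*} (B : ∀ e : G.graph.edgeSet, G.Interval e → Ω → ℝ)
    (u : G.Point) (ω : Ω) : G.bridgeSum B u ω = G.bridgeEval u (fun e t => B e t ω) := by
  rcases u with v | ⟨e, x⟩ <;> rfl

variable {G} in
theorem auxField_sub_eq {Ω : Type*} {Zvert : Vert → Ω → ℝ}
    {B : ∀ e : G.graph.edgeSet, G.Interval e → Ω → ℝ} (u v : G.Point) :
    (fun ω => G.auxField Zvert B u ω - G.auxField Zvert B v ω) =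
      (fun ω => (G.interpolated Zvert u ω - G.interpolated Zvert v ω) +
        (G.bridgeSum B u ω - G.bridgeSum B v ω)) := by
  ext ω
  simp only [auxField]
  ring

end Bridges

/-! ### Increments of the auxiliary field and positivity of the resistance. -/

section Field

variable {Vert : Type*} [Fintype Vert] [DecidableEq Vert] (G : EuclideanEdgeGraph Vert)

/-- The interpolation weights of a point at the vertices. -/
noncomputable def interpWeights : G.Point → EuclideanSpace ℝ Vert
  | Sum.inl v => EuclideanSpace.single v 1
  | Sum.inr ⟨e, x⟩ => (1 - G.relPos e x) • EuclideanSpace.single (G.src e) 1 +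
      G.relPos e x • EuclideanSpace.single (G.tgt e) 1

theorem interpolated_eq_inner {Ω : Type*} (Zvert : Vert → Ω → ℝ) (u : G.Point) (ω : Ω) :
    G.interpolated Zvert u ω =
      inner ℝ (G.interpWeights u) (WithLp.toLp 2 fun v => Zvert v ω) := by
  rcases u with v | ⟨e, x⟩
  · simp [interpolated, interpWeights, EuclideanSpace.inner_single_left]
  · simp [interpolated, interpWeights, inner_add_left, real_inner_smul_left,
      EuclideanSpace.inner_single_left]

variable {G} {u₀ : Vert} {Ω : Type*} {Zvert : Vert → Ω → ℝ}

theorem interpolated_sub_eq_inner (u v : G.Point) :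
    (fun ω => G.interpolated Zvert u ω - G.interpolated Zvert v ω) =
      fun ω => inner ℝ (G.interpWeights u - G.interpWeights v)
        (WithLp.toLp 2 fun w => Zvert w ω) := by
  ext ω
  rw [interpolated_eq_inner, interpolated_eq_inner, inner_sub_left]

variable [MeasurableSpace Ω] {P : Measure Ω} {B : ∀ e : G.graph.edgeSet, G.Interval e → Ω → ℝ}

theorem measurable_auxField (hZ : IsAuxiliaryInput G u₀ P Zvert B) (u : G.Point) :
    Measurable (G.auxField Zvert B u) := by
  have hv := hZ.measurable_vert
  have hb := fun e => (hZ.bridge e).measurable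
  rcases u with v | ⟨e, x⟩
  · exact (hv v).add measurable_const
  · exact ((measurable_const.mul (hv _)).add (measurable_const.mul (hv _))).add (hb e _)

theorem hasGaussianLaw_interpolated_sub (hZ : IsAuxiliaryInput G u₀ P Zvert B) (u v : G.Point) :
    HasGaussianLaw (fun ω => G.interpolated Zvert u ω - G.interpolated Zvert v ω) P := by
  rw [interpolated_sub_eq_inner]
  exact hZ.law_vert.hasGaussianLaw.map_fun (innerSL ℝ (G.interpWeights u - G.interpWeights v))

theorem integral_interpolated_sub (hZ : IsAuxiliaryInput G u₀ P Zvert B) (u v : G.Point) :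
    ∫ ω, (G.interpolated Zvert u ω - G.interpolated Zvert v ω) ∂P = 0 := by
  rw [interpolated_sub_eq_inner]
  set c := G.interpWeights u - G.interpWeights v
  have h := hZ.law_vert.integral_comp (f := fun x => inner ℝ c x) (by fun_prop)
  refine h.trans ?_
  rw [integral_inner IsGaussian.integrable_fun_id, integral_id_multivariateGaussian, inner_zero_right]

theorem variance_inner_vert_pos (hZ : IsAuxiliaryInput G u₀ P Zvert B) {c : EuclideanSpace ℝ Vert}
    (hc : c ≠ 0) : 0 < Var[fun ω => inner ℝ c (WithLp.toLp 2 fun w => Zvert w ω); P] := by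
  have hpd := (G.posDef_modLaplacian u₀).inv
  have h : Var[fun ω => inner ℝ c (WithLp.toLp 2 fun w => Zvert w ω); P] =
      Var[fun x => inner ℝ c x; multivariateGaussian 0 (G.modLaplacian u₀)⁻¹] := by
    rw [← hZ.law_vert.map_eq, variance_map (by fun_prop) hZ.law_vert.aemeasurable]
    rfl
  rw [h, ← covarianceBilin_self IsGaussian.memLp_two_id,
    covarianceBilin_multivariateGaussian hpd.posSemidef]
  have hc' : c.ofLp ≠ 0 := fun h0 => hc (by ext i; exact congrFun h0 i)
  simpa using hpd.dotProduct_mulVec_pos hc'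

theorem indepFun_interpolated_bridgeSum (hZ : IsAuxiliaryInput G u₀ P Zvert B) (u v : G.Point) :
    IndepFun (fun ω => G.interpolated Zvert u ω - G.interpolated Zvert v ω)
      (fun ω => G.bridgeSum B u ω - G.bridgeSum B v ω) P := by
  rw [interpolated_sub_eq_inner]
  simp only [bridgeSum_eq_bridgeEval]
  exact hZ.indep_vert_bridges.comp
    (φ := fun z : Vert → ℝ => inner ℝ (G.interpWeights u - G.interpWeights v) (WithLp.toLp 2 z))
    (ψ := fun p => G.bridgeEval u p - G.bridgeEval v p) (by fun_prop)
    ((G.measurable_bridgeEval u).sub (G.measurable_bridgeEval v))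

variable [IsProbabilityMeasure P]

/-- Two points inside one edge see increments of a single bridge, points on different edges see
independent bridges, and a vertex sees none. Positivity excludes pairs of vertices, where the
increment vanishes. -/
theorem bridgeSum_sub_law (hZ : IsAuxiliaryInput G u₀ P Zvert B) (u v : G.Point) :
    HasGaussianLaw (fun ω => G.bridgeSum B u ω - G.bridgeSum B v ω) P ∧
      ∫ ω, (G.bridgeSum B u ω - G.bridgeSum B v ω) ∂P = 0 ∧
      (u ≠ v → (∀ a b, u = Sum.inl a → v = Sum.inl b → False) →
        0 < Var[fun ω => G.bridgeSum B u ω - G.bridgeSum B v ω; P]) := by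
  have hg : ∀ e t, HasGaussianLaw (B e t) P := fun e t =>
    (hZ.bridge e).hasGaussianLaw t
  rcases u with a | ⟨e, x⟩ <;> rcases v with b | ⟨f, y⟩
  · simp only [bridgeSum, sub_self, integral_zero]
    exact ⟨hasGaussianLaw_const_real 0, trivial, fun _ h => (h a b rfl rfl).elim⟩
  · simp only [bridgeSum, zero_sub]
    refine ⟨(hg f _).fun_neg, by rw [integral_neg, (hZ.bridge f).mean_zero, neg_zero],
      fun _ _ => ?_⟩
    rw [variance_fun_neg, ← covariance_self (hg f _).aemeasurable]
    exact (hZ.bridge f).variance_pos (G.chart f y).2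
  · simp only [bridgeSum, sub_zero]
    refine ⟨hg e _, (hZ.bridge e).mean_zero _, fun _ _ => ?_⟩
    rw [← covariance_self (hg e _).aemeasurable]
    exact (hZ.bridge e).variance_pos (G.chart e x).2
  · have hmean : ∫ ω, (G.bridgeSum B (Sum.inr ⟨e, x⟩) ω - G.bridgeSum B (Sum.inr ⟨f, y⟩) ω) ∂P =
        0 := by
      simp only [bridgeSum]
      rw [integral_sub (hg e _).integrable (hg f _).integrable, (hZ.bridge e).mean_zero,
        (hZ.bridge f).mean_zero, sub_zero]
    by_cases hef : e = f
    · subst hef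
      refine ⟨(hZ.bridge e).hasGaussianLaw_sub _ _, hmean, fun hne _ => ?_⟩
      refine (hZ.bridge e).variance_sub_pos (G.chart e x).2 (G.chart e y).2 fun h => hne ?_
      rw [(G.chart e).injective (Subtype.ext h)]
    · have hind : IndepFun (B e ⟨G.chart e x, Set.Ioo_subset_Icc_self (G.chart e x).2⟩)
          (B f ⟨G.chart f y, Set.Ioo_subset_Icc_self (G.chart f y).2⟩) P :=
        (hZ.indep_bridges.indepFun hef).comp (measurable_pi_apply _) (measurable_pi_apply _)
      refine ⟨(hind.hasGaussianLaw (hg e _) (hg f _)).fun_sub, hmean, fun _ _ => ?_⟩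
      simp only [bridgeSum]
      rw [variance_fun_sub_eq (hg e _).memLp_two (hg f _).memLp_two,
        hind.covariance_eq_zero (hg e _).memLp_two (hg f _).memLp_two]
      have h1 := (hZ.bridge e).variance_pos (t := ⟨G.chart e x,
        Set.Ioo_subset_Icc_self (G.chart e x).2⟩) (G.chart e x).2
      have h2 := (hZ.bridge f).variance_pos (t := ⟨G.chart f y,
        Set.Ioo_subset_Icc_self (G.chart f y).2⟩) (G.chart f y).2
      linarith

/-- The increments of the auxiliary field are centred Gaussian with variance the resistance. -/
theorem map_auxField_sub (hZ : IsAuxiliaryInput G u₀ P Zvert B) (u v : G.Point) :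
    P.map (fun ω => G.auxField Zvert B u ω - G.auxField Zvert B v ω) =
      gaussianReal 0 (resistance P (G.auxField Zvert B) u v).toNNReal := by
  have hI := hasGaussianLaw_interpolated_sub hZ u v
  have hD := (bridgeSum_sub_law hZ u v).1
  have hg : HasGaussianLaw (fun ω => G.auxField Zvert B u ω - G.auxField Zvert B v ω) P := by
    rw [auxField_sub_eq]
    exact ((indepFun_interpolated_bridgeSum hZ u v).hasGaussianLaw hI hD).fun_add
  have hm : ∫ ω, (G.auxField Zvert B u ω - G.auxField Zvert B v ω) ∂P = 0 := by
    rw [auxField_sub_eq, integral_add hI.integrable hD.integrable, integral_interpolated_sub hZ,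
      (bridgeSum_sub_law hZ u v).2.1, add_zero]
  rw [hg.map_eq_gaussianReal, hm]
  rfl

/-- By independence the variance is a vertex part plus a bridge part. The first is positive for two
distinct vertices, the second for every other pair of distinct points. -/
theorem resistance_pos (hZ : IsAuxiliaryInput G u₀ P Zvert B) {u v : G.Point} (huv : u ≠ v) :
    0 < resistance P (G.auxField Zvert B) u v := by
  have hI := hasGaussianLaw_interpolated_sub hZ u v
  obtain ⟨hD, -, hpos⟩ := bridgeSum_sub_law hZ u v
  have hvar : resistance P (G.auxField Zvert B) u v =
      Var[fun ω => G.interpolated Zvert u ω - G.interpolated Zvert v ω; P] +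
      Var[fun ω => G.bridgeSum B u ω - G.bridgeSum B v ω; P] := by
    rw [resistance, auxField_sub_eq]
    exact (indepFun_interpolated_bridgeSum hZ u v).variance_add hI.memLp_two hD.memLp_two
  rw [hvar]
  by_cases h : ∃ a b, u = Sum.inl a ∧ v = Sum.inl b
  · obtain ⟨a, b, rfl, rfl⟩ := h
    refine add_pos_of_pos_of_nonneg ?_ (variance_nonneg _ _)
    rw [interpolated_sub_eq_inner]
    refine variance_inner_vert_pos hZ fun h0 => huv ?_
    have := congrArg (fun c : EuclideanSpace ℝ Vert => c a) h0
    by_contra hab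
    have hab' : a ≠ b := fun h => hab (by rw [h])
    simp [interpWeights, hab'] at this
  · exact add_pos_of_nonneg_of_pos (variance_nonneg _ _)
      (hpos huv fun a b ha hb => h ⟨a, b, ha, hb⟩)

end Field

end EuclideanEdgeGraph

/-! ### Independence bookkeeping and marginals of mixtures. -/

section Independence

variable {Ω : Type*} [MeasurableSpace Ω] {P : Measure Ω}

/-- Splitting the independence of a field and three variables, for two points of the field. -/
theorem indepFun_of_iIndep_field {T : Type*} {Z : T → Ω → ℝ} {V Λ W : Ω → ℝ}
    (hZm : ∀ t, Measurable (Z t)) (hVm : Measurable V) (hΛm : Measurable Λ) (hWm : Measurable W)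
    (h : iIndep ![MeasurableSpace.comap (fun ω (t : T) => Z t ω) inferInstance,
      MeasurableSpace.comap V inferInstance, MeasurableSpace.comap Λ inferInstance,
      MeasurableSpace.comap W inferInstance] P) (s t : T) :
    IndepFun (fun ω => (Z s ω, Z t ω)) W P ∧ IndepFun V Λ P ∧
      IndepFun (fun ω => ((Z s ω, Z t ω), W ω)) (fun ω => (V ω, Λ ω)) P := by
  -- Padding with zeros gives all four variables the same codomain.
  let f : Fin 4 → Ω → ℝ × ℝ := ![fun ω => (Z s ω, Z t ω), fun ω => (V ω, 0), fun ω => (Λ ω, 0),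
    fun ω => (W ω, 0)]
  have hfm : ∀ i, Measurable (f i) := by
    intro i
    fin_cases i
    · exact (hZm s).prodMk (hZm t)
    · exact hVm.prodMk measurable_const
    · exact hΛm.prodMk measurable_const
    · exact hWm.prodMk measurable_const
  have hpair : ∀ X : Ω → ℝ, Measurable[MeasurableSpace.comap X inferInstance]
      (fun ω => (X ω, (0 : ℝ))) := fun X =>
    (measurable_id.prodMk measurable_const).comp (comap_measurable X)
  have hf : iIndepFun f P := by
    rw [iIndepFun_iff_iIndep]
    refine iIndep_of_iIndep_of_le h fun i => ?_
    fin_cases i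
    · refine Measurable.comap_le ?_
      exact ((measurable_pi_apply s).prodMk (measurable_pi_apply t)).comp
        (comap_measurable fun ω (t : T) => Z t ω)
    · exact (hpair V).comap_le
    · exact (hpair Λ).comap_le
    · exact (hpair W).comap_le
  refine ⟨?_, ?_, ?_⟩
  · exact (hf.indepFun (i := 0) (j := 3) (by decide)).comp measurable_id measurable_fst
  · exact (hf.indepFun (i := 1) (j := 2) (by decide)).comp measurable_fst measurable_fst
  · exact (hf.indepFun_prodMk_prodMk hfm 0 3 1 2 (by decide) (by decide) (by decide)
      (by decide)).comp
      (φ := fun q : (ℝ × ℝ) × (ℝ × ℝ) => (q.1, q.2.1))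
      (ψ := fun q : (ℝ × ℝ) × (ℝ × ℝ) => (q.1.1, q.2.1)) (by fun_prop) (by fun_prop)

theorem isProbabilityMeasure_corrLaw (F : Measure ℝ) [IsProbabilityMeasure F] (d : ℝ) :
    IsProbabilityMeasure (corrLaw F d) :=
  Measure.isProbabilityMeasure_map (by fun_prop)

/-- The first marginal of a mixture of standard bivariate Gaussian laws is standard Gaussian. -/
theorem map_fst_bind_bivariateGaussian {μ : Measure ℝ} [IsProbabilityMeasure μ]
    (hμ : ∀ᵐ r ∂μ, |r| ≤ 1) : (μ.bind bivariateGaussian).map Prod.fst = gaussianReal 0 1 := by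
  ext s hs
  rw [Measure.map_apply measurable_fst hs,
    Measure.bind_apply (measurable_fst hs) (aemeasurable_bivariateGaussian hμ)]
  have h : ∀ᵐ r ∂μ, bivariateGaussian r (Prod.fst ⁻¹' s) = gaussianReal 0 1 s := by
    filter_upwards [hμ] with r hr
    rw [← Measure.map_apply measurable_fst hs, map_fst_bivariateGaussian hr]
  rw [lintegral_congr_ae h]
  simp

end Independence

/-! ### The four claims assembled. -/

theorem proposition2 {Vert : Type*} [Fintype Vert] [DecidableEq Vert]
    (G : EuclideanEdgeGraph Vert) (u₀ : Vert)
    {Ω : Type*} [MeasurableSpace Ω] (P : Measure Ω) [IsProbabilityMeasure P]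
    (Zvert : Vert → Ω → ℝ) (B : ∀ e : G.graph.edgeSet, G.Interval e → Ω → ℝ)
    (hZ : IsAuxiliaryInput G u₀ P Zvert B)
    (F : Measure ℝ) [IsProbabilityMeasure F] (hF : F {0} = 0)
    (V Λ W : Ω → ℝ) (hVm : Measurable V) (hΛm : Measurable Λ) (hWm : Measurable W)
    (hV : pdf.IsUniform V (Set.Ioo 0 1) P) (hΛ : pdf.IsUniform Λ (Set.Ioo 0 (2 * Real.pi)) P)
    (hW : HasLaw W F P)
    (hindep : iIndep
      ![MeasurableSpace.comap (fun ω (u : G.Point) => G.auxField Zvert B u ω) inferInstance,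
        MeasurableSpace.comap V inferInstance,
        MeasurableSpace.comap Λ inferInstance,
        MeasurableSpace.comap W inferInstance] P)
    (dR : G.Point → G.Point → ℝ) (hdR : dR = resistance P (G.auxField Zvert B))
    (Y : G.Point → Ω → ℝ) (hY : Y = spectralField (G.auxField Zvert B) V Λ W) :
    -- standard Gaussian marginals
    (∀ u, HasLaw (Y u) (gaussianReal 0 1) P) ∧
    -- isotropy of the bivariate laws
    (∀ u v u' v', dR u v = dR u' v' →
      P.map (fun ω => (Y u ω, Y v ω)) = P.map (fun ω => (Y u' ω, Y v' ω))) ∧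
    -- the bivariate laws are mixtures of bivariate Gaussian laws
    (∀ u v, P.map (fun ω => (Y u ω, Y v ω)) = (corrLaw F (dR u v)).bind bivariateGaussian) ∧
    -- bivariate densities and their isofactorial expansion
    (∀ u v, u ≠ v → ∃ g : ℝ × ℝ → ℝ≥0∞, Measurable g ∧
      P.map (fun ω => (Y u ω, Y v ω)) = (volume : Measure (ℝ × ℝ)).withDensity g ∧
      (∀ y y' : ℝ, |y| ≠ |y'| → g (y, y') ≠ ⊤) ∧
      ∀ y y' : ℝ, Tendsto
        (fun n : ℕ => ((gaussianPDFReal 0 1 y * gaussianPDFReal 0 1 y' *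
          ∑ ν ∈ Finset.range n, (∫ r, r ^ ν ∂(corrLaw F (dR u v))) *
            hermiteNormalized ν y * hermiteNormalized ν y' : ℝ) : EReal))
        atTop (𝓝 ((g (y, y') : ℝ≥0∞) : EReal))) := by
  have hZm := fun u => EuclideanEdgeGraph.measurable_auxField hZ u
  have hmix : ∀ u v, P.map (fun ω => (Y u ω, Y v ω)) =
      (corrLaw F (dR u v)).bind bivariateGaussian := by
    intro u v
    obtain ⟨h1, h2, h3⟩ := indepFun_of_iIndep_field hZm hVm hΛm hWm hindep u v
    subst hY hdR
    exact map_spectral_pair_eq_bind (X := fun ω => (G.auxField Zvert B u ω, G.auxField Zvert B v ω))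
      ((hZm u).prodMk (hZm v)) hVm hΛm hWm hV hΛ hW.map_eq h1 h2 h3 (variance_nonneg _ _)
      (EuclideanEdgeGraph.map_auxField_sub hZ u v)
  have hYm : ∀ u, Measurable (Y u) := by
    intro u
    have := hZm u
    subst hY
    unfold spectralField
    fun_prop
  refine ⟨fun u => ⟨(hYm u).aemeasurable, ?_⟩, fun u v u' v' h => by rw [hmix, hmix, h], hmix,
    fun u v huv => ?_⟩
  -- The one-point law is the first marginal of the diagonal pair `(Y u, Y u)`.
  · have := isProbabilityMeasure_corrLaw F (dR u u)
    rw [← map_fst_bind_bivariateGaussian (abs_le_one_ae_corrLaw F (dR u u)), ← hmix u u,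
      Measure.map_map measurable_fst ((hYm u).prodMk (hYm u))]
    rfl
  · have := isProbabilityMeasure_corrLaw F (dR u v)
    have hd : 0 < dR u v := hdR ▸ EuclideanEdgeGraph.resistance_pos hZ huv
    have hae := abs_lt_one_ae_corrLaw hF hd
    refine ⟨fun p => ∫⁻ r, ENNReal.ofReal (mehlerKernel r p.1 p.2) ∂(corrLaw F (dR u v)), ?_, ?_,
      fun y y' hy => lintegral_mehlerKernel_ne_top hae hy,
      fun y y' => tendsto_isofactorial_mixture hae y y'⟩
    · exact Measurable.lintegral_prod_left'
        (f := fun q : ℝ × ℝ × ℝ => ENNReal.ofReal (mehlerKernel q.1 q.2.1 q.2.2))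
        measurable_mehlerKernel.ennreal_ofReal
    · rw [hmix, bind_bivariateGaussian_eq_withDensity hae]
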